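/- Let $\mathbb{S}^2\subset\mathbb{R}^3$ be the unit sphere with surface measure $\sigma$, $(Y_{\ell,m})_{\ell\ge 0,\,-\ell\le m\le\ell}$ the spherical harmonics (orthonormal in $L^2(\mathbb{S}^2)$, $\Delta_{\mathbb{S}^2}Y_{\ell,m}=-\ell(\ell+1)Y_{\ell,m}$), $f^{\ell,m}=(f,Y_{\ell,m})_{L^2(\mathbb{S}^2)}$, and $\|f\|_{H^s(\mathbb{S}^2)}^2=\sum_{\ell,m}(1+\ell(\ell+1))^s|f^{\ell,m}|^2$. Let $T>0$, and let $$W(t)=\sum_{\ell,m}a^{\ell,m}(t)Y_{\ell,m}=\sum_{\ell=0}^\infty\Big(\sqrt{A_\ell}\,\beta_1^{\ell,0}(t)Y_{\ell,0}+\sqrt{2A_\ell}\sum_{m=1}^\ell\big(\beta_1^{\ell,m}(t)\,\mathrm{Re}\,Y_{\ell,m}+\beta_2^{\ell,m}(t)\,\mathrm{Im}\,Y_{\ell,m}\big)\Big)$$ be an isotropic $Q$-Wiener process with angular power spectrum $A_\ell\ge0$, where $\beta_1^{\ell,m}$ ($0\le m\le \ell$) and $\beta_2^{\ell,m}$ ($1\le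 m\le\ell$) are independent real standard Brownian motions. Assume that there are $\ell_0\in\mathbb{N}$, $\alpha>2$ and $C>0$ with $A_\ell\le C\ell^{-\alpha}$ for all $\ell>\ell_0$. Let $v_1,v_2\in L^2(\mathbb{S}^2)$ be non-random with $v_1\in H^\beta(\mathbb{S}^2)$, $v_2\in H^\gamma(\mathbb{S}^2)$, and let $u_j(t)=\sum_{\ell=0}^\infty\sum_{m=-\ell}^\ell u_j^{\ell,m}(t)Y_{\ell,m}$, $j=1,2$, be the solution on $[0,T]$ of the stochastic wave equation $\partial_{tt}u-\Delta_{\mathbb{S}^2}u=\dot W$, $u(0)=v_1$, $\partial_tu(0)=v_2$, with $u_1=u$ and $u_2=\partial_tu$: the coefficients have continuous paths and satisfy, almost surely for all $t\in[0,T]$, $$u_1^{\ell,m}(t)=v_1^{\ell,m}+\int_0^tu_2^{\ell,m}(s)\,ds,\qquad u_2^{\ell,m}(t)=v_2^{\ell,m}-\ell(\ell+1)\int_0^tu_1^{\ell,m}(s)\,ds+a^{\ell,m}(t).$$ Let $t\in[0,T]$, let $0=t_0<\dots<t_n=t$ be a time grid, and let $u_j^\kappa(t)=\sum_{\ell=0}^\kappa\sum_{m=-\ell}^\ell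 U_j^{\ell,m}(t_n)Y_{\ell,m}$, where the coefficients are computed recursively on the grid from $U_j^{\ell,m}(t_0)=v_j^{\ell,m}$ by $$\begin{pmatrix}U_1^{\ell,m}\\U_2^{\ell,m}\end{pmatrix}(t_{i+1})=\begin{pmatrix}R_2^\ell(h_i)&R_1^\ell(h_i)\\-\ell(\ell+1)R_1^\ell(h_i)&R_2^\ell(h_i)\end{pmatrix}\begin{pmatrix}U_1^{\ell,m}\\U_2^{\ell,m}\end{pmatrix}(t_i)+\int_{t_i}^{t_{i+1}}\begin{pmatrix}R_1^\ell\\R_2^\ell\end{pmatrix}(t_{i+1}-s)\,da^{\ell,m}(s),$$ with $h_i=t_{i+1}-t_i$, $R_1^\ell(t)=(\ell(\ell+1))^{-1/2}\sin(t(\ell(\ell+1))^{1/2})$ for $\ell\ne0$, $R_1^0(t)=t$, and $R_2^\ell(t)=\cos(t(\ell(\ell+1))^{1/2})$. Then there is a constant $\hat C$ depending only on $C$, $T$ and $\alpha$ (in particular uniform in $t\in[0,T]$ and independent of the time grid) such that the following holds for all integers $\kappa>\ell_0$. If $\beta\ge0$ and $\gamma\ge-1$, then the series of $u_1(t)$ converges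 almost surely in $L^2(\mathbb{S}^2)$, $u_1(t)$ and $u_1^\kappa(t)$ belong to $L^2(\Omega;L^2(\mathbb{S}^2))$, and $$\big\|\mathbb{E}[u_1(t)-u_1^\kappa(t)]\big\|_{L^2(\mathbb{S}^2)}\le\hat C\big(\kappa^{-\beta}\|v_1\|_{H^\beta(\mathbb{S}^2)}+\kappa^{-(\gamma+1)}\|v_2\|_{H^\gamma(\mathbb{S}^2)}\big),$$ $$\Big|\mathbb{E}\big[\|u_1(t)\|^2_{L^2(\mathbb{S}^2)}-\|u_1^\kappa(t)\|^2_{L^2(\mathbb{S}^2)}\big]\Big|\le\hat C\big(\kappa^{-\alpha}+\kappa^{-2\beta}\|v_1\|^2_{H^\beta(\mathbb{S}^2)}+\kappa^{-2(\gamma+1)}\|v_2\|^2_{H^\gamma(\mathbb{S}^2)}\big).$$ If $\beta\ge1$ and $\gamma\ge0$, then the series of $u_2(t)$ converges almost surely in $L^2(\mathbb{S}^2)$, $u_2(t)$ and $u_2^\kappa(t)$ belong to $L^2(\Omega;L^2(\mathbb{S}^2))$, and $$\big\|\mathbb{E}[u_2(t)-u_2^\kappa(t)]\big\|_{L^2(\mathbb{S}^2)}\le\hat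 C\big(\kappa^{-(\beta-1)}\|v_1\|_{H^\beta(\mathbb{S}^2)}+\kappa^{-\gamma}\|v_2\|_{H^\gamma(\mathbb{S}^2)}\big),$$ $$\Big|\mathbb{E}\big[\|u_2(t)\|^2_{L^2(\mathbb{S}^2)}-\|u_2^\kappa(t)\|^2_{L^2(\mathbb{S}^2)}\big]\Big|\le\hat C\big(\kappa^{-(\alpha-2)}+\kappa^{-2(\beta-1)}\|v_1\|^2_{H^\beta(\mathbb{S}^2)}+\kappa^{-2\gamma}\|v_2\|^2_{H^\gamma(\mathbb{S}^2)}\big).$$ -/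

import Mathlib

open MeasureTheory ProbabilityTheory
open scoped NNReal

namespace SphereWave

/-! ### The unit sphere and its surface measure -/

/-- The unit sphere in `ℝ³`. -/
abbrev S2 : Type := Metric.sphere (0 : EuclideanSpace ℝ (Fin 3)) 1

/-- The point with polar angle `p.1 = ϑ` and azimuth `p.2 = φ`, that is
`(sin ϑ cos φ, sin ϑ sin φ, cos ϑ)`. -/
noncomputable def angularPoint (p : ℝ × ℝ) : S2 :=
  ⟨!₂[Real.sin p.1 * Real.cos p.2, Real.sin p.1 * Real.sin p.2, Real.cos p.1], by
    rw [mem_sphere_zero_iff_norm, EuclideanSpace.norm_eq, Fin.sum_univ_three]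
    simp only [Matrix.cons_val_zero, Matrix.cons_val_one, Matrix.cons_val,
      Real.norm_eq_abs, sq_abs]
    rw [Real.sqrt_eq_one]
    nlinarith [Real.sin_sq_add_cos_sq p.1, Real.sin_sq_add_cos_sq p.2]⟩

theorem continuous_angularPoint : Continuous angularPoint := by
  refine Continuous.subtype_mk ?_ _
  refine (PiLp.continuous_toLp 2 _).comp (continuous_pi fun i => ?_)
  fin_cases i <;> simp <;> fun_prop

/-- The measure `sin ϑ dϑ dφ` on the parameter rectangle `[0, π] × [0, 2π)`. -/
noncomputable def angularMeasure : Measure (ℝ × ℝ) :=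
  (volume.restrict (Set.Icc 0 Real.pi ×ˢ Set.Ico 0 (2 * Real.pi))).withDensity
    fun p => ENNReal.ofReal (Real.sin p.1)

/-- The Lebesgue (surface) measure `dσ = sin ϑ dϑ dφ` on the sphere. -/
noncomputable def surfaceMeasure : Measure S2 := angularMeasure.map angularPoint

instance : IsFiniteMeasure angularMeasure := by
  have : IsFiniteMeasure ((volume : Measure (ℝ × ℝ)).restrict
      (Set.Icc 0 Real.pi ×ˢ Set.Ico 0 (2 * Real.pi))) := by
    refine ⟨?_⟩
    rw [Measure.restrict_apply_univ, Measure.volume_eq_prod, Measure.prod_prod]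
    simp [ENNReal.mul_lt_top]
  refine isFiniteMeasure_withDensity_ofReal (Integrable.hasFiniteIntegral ?_)
  refine Integrable.of_bound (by fun_prop) 1 (Filter.Eventually.of_forall fun p => ?_)
  simpa using Real.abs_sin_le_one p.1

instance : IsFiniteMeasure surfaceMeasure := by
  unfold surfaceMeasure; infer_instance

/-- The space `L²(𝕊²)` of complex-valued square integrable functions. The real-valued functions
are a closed real subspace of it, with the same norm. -/
abbrev L2 : Type := Lp ℂ 2 surfaceMeasure

/-! ### Spherical harmonics -/

/-- Legendre polynomial, by Rodrigues' formula. -/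
noncomputable def legendre (l : ℕ) : Polynomial ℝ :=
  Polynomial.C ((2 ^ l * (l.factorial : ℝ))⁻¹) *
    Polynomial.derivative^[l] ((Polynomial.X ^ 2 - 1) ^ l)

/-- The normalizing factor `√((2ℓ+1)/(4π) · (ℓ-m)!/(ℓ+m)!)` (for `m ≤ ℓ`). -/
noncomputable def harmonicNorm (l m : ℕ) : ℝ :=
  Real.sqrt ((2 * l + 1) / (4 * Real.pi) * ((l - m).factorial / (l + m).factorial))

/-- Spherical harmonic of order `m ≥ 0`, in Cartesian coordinates: since
`sin ϑ e^{iφ} = y₁ + i y₂` and `cos ϑ = y₃`, this is the usual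
`√((2ℓ+1)/(4π) · (ℓ-m)!/(ℓ+m)!) P_{ℓ,m}(cos ϑ) e^{imφ}`, see `harmonicNonneg_angularPoint`. -/
noncomputable def harmonicNonneg (l m : ℕ) (y : S2) : ℂ :=
  ((harmonicNorm l m * ((-1) ^ m * (Polynomial.derivative^[m] (legendre l)).eval (y.1 2)) : ℝ) : ℂ)
    * ((y.1 0 : ℂ) + (y.1 1 : ℂ) * Complex.I) ^ m

/-- The spherical harmonic `Y_{ℓ,m}`, `-ℓ ≤ m ≤ ℓ`, with `Y_{ℓ,m} = (-1)^m conj Y_{ℓ,-m}` for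
negative `m`. -/
noncomputable def harmonicFun (l : ℕ) (m : ℤ) (y : S2) : ℂ :=
  if 0 ≤ m then harmonicNonneg l m.natAbs y
  else (-1) ^ m.natAbs * (starRingEnd ℂ) (harmonicNonneg l m.natAbs y)

/-- The associated Legendre function
`P_{ℓ,m}(μ) = (-1)^m (1-μ²)^{m/2} (d/dμ)^m P_ℓ(μ)`. -/
noncomputable def assocLegendre (l m : ℕ) (μ : ℝ) : ℝ :=
  (-1) ^ m * (1 - μ ^ 2) ^ ((m : ℝ) / 2) * (Polynomial.derivative^[m] (legendre l)).eval μ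

/-- The Cartesian form agrees with the definition in angular coordinates. -/
theorem harmonicNonneg_angularPoint (l m : ℕ) {ϑ : ℝ} (h : ϑ ∈ Set.Icc 0 Real.pi) (φ : ℝ) :
    harmonicNonneg l m (angularPoint (ϑ, φ)) =
      (harmonicNorm l m : ℂ) * (assocLegendre l m (Real.cos ϑ) : ℂ) *
        Complex.exp (Complex.I * m * φ) := by
  have hs : 0 ≤ Real.sin ϑ := Real.sin_nonneg_of_mem_Icc h
  have h1 : (1 - Real.cos ϑ ^ 2) ^ ((m : ℝ) / 2) = Real.sin ϑ ^ m := by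
    rw [← Real.sin_sq, ← Real.rpow_natCast (Real.sin ϑ) 2, ← Real.rpow_mul hs,
      ← Real.rpow_natCast (Real.sin ϑ) m]
    congr 1
    push_cast
    ring
  have h2 : Complex.exp (Complex.I * m * φ) =
      ((Real.cos φ : ℂ) + (Real.sin φ : ℂ) * Complex.I) ^ m := by
    rw [Complex.ofReal_cos, Complex.ofReal_sin, ← Complex.exp_mul_I, ← Complex.exp_nat_mul]
    congr 1
    ring
  have h3 : ((Real.sin ϑ * Real.cos φ : ℝ) : ℂ) + ((Real.sin ϑ * Real.sin φ : ℝ) : ℂ) * Complex.I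
      = (Real.sin ϑ : ℂ) * ((Real.cos φ : ℂ) + (Real.sin φ : ℂ) * Complex.I) := by
    push_cast
    ring
  have e0 : (angularPoint (ϑ, φ)).1 0 = Real.sin ϑ * Real.cos φ := rfl
  have e1 : (angularPoint (ϑ, φ)).1 1 = Real.sin ϑ * Real.sin φ := rfl
  have e2 : (angularPoint (ϑ, φ)).1 2 = Real.cos ϑ := rfl
  rw [harmonicNonneg, assocLegendre, e0, e1, e2, h1, h2, h3, mul_pow]
  push_cast
  ring

theorem continuous_harmonicNonneg (l m : ℕ) : Continuous (harmonicNonneg l m) := by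
  unfold harmonicNonneg
  fun_prop

theorem continuous_harmonicFun (l : ℕ) (m : ℤ) : Continuous (harmonicFun l m) := by
  have h := continuous_harmonicNonneg l m.natAbs
  unfold harmonicFun
  split_ifs
  · exact h
  · exact continuous_const.mul (Complex.continuous_conj.comp h)

/-- The spherical harmonic `Y_{ℓ,m}` as an element of `L²(𝕊²)`. -/
noncomputable def harmonic (l : ℕ) (m : ℤ) : L2 :=
  ContinuousMap.toLp 2 surfaceMeasure ℂ ⟨harmonicFun l m, continuous_harmonicFun l m⟩

/-- The admissible orders `m = -ℓ, …, ℓ`. -/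
noncomputable abbrev orders (l : ℕ) : Finset ℤ := Finset.Icc (-(l : ℤ)) l

/-- The coefficient `f^{ℓ,m} = (f, Y_{ℓ,m})_{L²} = ∫ f conj Y_{ℓ,m} dσ`. -/
noncomputable def coeff (f : L2) (l : ℕ) (m : ℤ) : ℂ := inner ℂ (harmonic l m) f

/-! ### Sobolev spaces: the spherical Laplacian has eigenvalue `-ℓ(ℓ+1)` on `Y_{ℓ,m}` -/

/-- `|((Id - Δ)^{s/2} f)^{ℓ,·}|²`, the contribution of degree `ℓ` to `‖f‖²_{H^s}`. -/
noncomputable def sobolevTerm (s : ℝ) (f : L2) (l : ℕ) : ℝ :=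
  (1 + (l : ℝ) * (l + 1)) ^ s * ∑ m ∈ orders l, ‖coeff f l m‖ ^ 2

/-- `f ∈ H^s(𝕊²)`, for `f ∈ L²(𝕊²)`: the spectral series of `(Id - Δ)^{s/2} f` converges. -/
def MemSobolev (s : ℝ) (f : L2) : Prop := Summable (sobolevTerm s f)

/-- `‖f‖_{H^s} = ‖(Id - Δ)^{s/2} f‖_{L²}`, for `f ∈ H^s(𝕊²)`. -/
noncomputable def sobolevNorm (s : ℝ) (f : L2) : ℝ := Real.sqrt (∑' l, sobolevTerm s f l)

/-! ### The driving noise -/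

section Noise

variable {Ω : Type*}

/-- `(β₁^{ℓ,m}, 0 ≤ m ≤ ℓ)` and `(β₂^{ℓ,m}, 1 ≤ m ≤ ℓ)` are independent standard real Brownian
motions with continuous paths. Here `β 0` stands for `β₁` and `β 1` for `β₂`. -/
structure IsBrownianFamily [MeasurableSpace Ω] (β : Fin 2 → ℕ → ℕ → ℝ≥0 → Ω → ℝ) (P : Measure Ω) : Prop where
  brownian : ∀ i l m, m ≤ l → (i = 1 → 1 ≤ m) → IsPreBrownianReal (β i l m) P
  continuous : ∀ i l m, m ≤ l → (i = 1 → 1 ≤ m) → ∀ᵐ ω ∂P, Continuous fun t => β i l m t ω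
  indep : iIndepFun
    (fun (k : {k : Fin 2 × ℕ × ℕ // k.2.2 ≤ k.2.1 ∧ (k.1 = 1 → 1 ≤ k.2.2)}) (ω : Ω) (t : ℝ≥0) =>
      β k.1.1 k.1.2.1 k.1.2.2 t ω) P

/-- The coefficients `a^{ℓ,m}(t)` with respect to `Y_{ℓ,m}` of the isotropic `Q`-Wiener process
`W(t) = ∑_ℓ (√A_ℓ β₁^{ℓ,0}(t) Y_{ℓ,0} + √(2A_ℓ) ∑_{m=1}^ℓ (β₁^{ℓ,m}(t) Re Y_{ℓ,m}
+ β₂^{ℓ,m}(t) Im Y_{ℓ,m}))` with angular power spectrum `(A_ℓ)`, see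
`noiseCoeff_zero` and `noiseCoeff_pos`. -/
noncomputable def noiseCoeff (A : ℕ → ℝ) (β : Fin 2 → ℕ → ℕ → ℝ≥0 → Ω → ℝ)
    (l : ℕ) (m : ℤ) (t : ℝ) (ω : Ω) : ℂ :=
  if m = 0 then (Real.sqrt (A l) * β 0 l 0 t.toNNReal ω : ℝ)
  else if 0 < m then
    (Real.sqrt (A l / 2) : ℂ) *
      ((β 0 l m.natAbs t.toNNReal ω : ℂ) - (β 1 l m.natAbs t.toNNReal ω : ℂ) * Complex.I)
  else
    (-1) ^ m.natAbs * (Real.sqrt (A l / 2) : ℂ) *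
      ((β 0 l m.natAbs t.toNNReal ω : ℂ) + (β 1 l m.natAbs t.toNNReal ω : ℂ) * Complex.I)

theorem noiseCoeff_zero (A : ℕ → ℝ) (β : Fin 2 → ℕ → ℕ → ℝ≥0 → Ω → ℝ)
    (l : ℕ) (t : ℝ) (ω : Ω) :
    noiseCoeff A β l 0 t ω = (Real.sqrt (A l) * β 0 l 0 t.toNNReal ω : ℝ) := by
  simp [noiseCoeff]

theorem noiseCoeff_pos (A : ℕ → ℝ) (β : Fin 2 → ℕ → ℕ → ℝ≥0 → Ω → ℝ)
    (l m : ℕ) (hm : 0 < m) (t : ℝ) (ω : Ω) (y : S2) :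
    noiseCoeff A β l m t ω * harmonicFun l m y + noiseCoeff A β l (-m) t ω * harmonicFun l (-m) y
      = (Real.sqrt (2 * A l) * (β 0 l m t.toNNReal ω * (harmonicFun l m y).re
          + β 1 l m t.toNNReal ω * (harmonicFun l m y).im) : ℝ) := by
  have h1 : (m : ℤ) ≠ 0 := by omega
  have h2 : (0 : ℤ) < m := by omega
  have h3 : ¬ (0 : ℤ) < -m := by omega
  have h4 : ¬ (0 : ℤ) ≤ -m := by omega
  have h5 : -(m : ℤ) ≠ 0 := by omega
  have hs : Real.sqrt (2 * A l) = 2 * Real.sqrt (A l / 2) := by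
    have e : 2 * A l = 2 ^ 2 * (A l / 2) := by ring
    rw [e, Real.sqrt_mul (by norm_num), Real.sqrt_sq (by norm_num)]
  have hp : ((-1 : ℂ) ^ m) * (-1) ^ m = 1 := by rw [← mul_pow]; simp
  simp only [noiseCoeff, harmonicFun, if_neg h1, if_neg h5, if_pos h2, if_neg h3, if_pos h2.le,
    if_neg h4, Int.natAbs_neg, Int.natAbs_natCast, hs]
  set z := harmonicNonneg l m y
  set b := β 0 l m t.toNNReal ω
  set c := β 1 l m t.toNNReal ω
  set r := Real.sqrt (A l / 2)
  have e : (-1 : ℂ) ^ m * (r : ℂ) * ((b : ℂ) + (c : ℂ) * Complex.I)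
      * ((-1) ^ m * (starRingEnd ℂ) z)
      = (r : ℂ) * ((b : ℂ) + (c : ℂ) * Complex.I) * (starRingEnd ℂ) z := by
    linear_combination (r : ℂ) * ((b : ℂ) + (c : ℂ) * Complex.I) * (starRingEnd ℂ) z * hp
  rw [e]
  apply Complex.ext <;> simp <;> ring

end Noise

/-! ### The stochastic wave equation -/

section Wave

variable {Ω : Type*}

/-- The coefficient processes `u₁^{ℓ,m}`, `u₂^{ℓ,m}` (position and velocity) of a solution, on the
time interval `[0, T]`, of the stochastic wave equation in integral form
`u₁(t) = v₁ + ∫₀ᵗ u₂(s) ds`, `u₂(t) = v₂ + ∫₀ᵗ Δ u₁(s) ds + W(t)`,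
where `a^{ℓ,m}` are the coefficient processes of the noise `W`: almost surely the paths are
continuous and satisfy the equation in every direction `Y_{ℓ,m}`. -/
structure IsWaveSolution [MeasurableSpace Ω] (P : Measure Ω) (T : ℝ) (v₁ v₂ : L2)
    (a u₁ u₂ : ℕ → ℤ → ℝ → Ω → ℂ) : Prop where
  continuous₁ : ∀ l, ∀ m ∈ orders l, ∀ᵐ ω ∂P,
    ContinuousOn (fun t => u₁ l m t ω) (Set.Icc 0 T)
  continuous₂ : ∀ l, ∀ m ∈ orders l, ∀ᵐ ω ∂P,
    ContinuousOn (fun t => u₂ l m t ω) (Set.Icc 0 T)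
  position : ∀ l, ∀ m ∈ orders l, ∀ᵐ ω ∂P, ∀ t ∈ Set.Icc 0 T,
    u₁ l m t ω = coeff v₁ l m + ∫ s in (0 : ℝ)..t, u₂ l m s ω
  velocity : ∀ l, ∀ m ∈ orders l, ∀ᵐ ω ∂P, ∀ t ∈ Set.Icc 0 T,
    u₂ l m t ω = coeff v₂ l m - ((l : ℂ) * (l + 1)) * (∫ s in (0 : ℝ)..t, u₁ l m s ω) + a l m t ω

/-- The random function `∑_{ℓ=0}^∞ ∑_{m=-ℓ}^ℓ u^{ℓ,m}(t) Y_{ℓ,m}` in `L²(𝕊²)` (the sum is `0` for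
those `ω` for which the series diverges). -/
noncomputable def field (u : ℕ → ℤ → ℝ → Ω → ℂ) (t : ℝ) (ω : Ω) : L2 :=
  ∑' l : ℕ, ∑ m ∈ orders l, u l m t ω • harmonic l m

/-- The series of `field` converges unconditionally in `L²(𝕊²)` for almost every `ω`. -/
def FieldConverges [MeasurableSpace Ω] (P : Measure Ω) (u : ℕ → ℤ → ℝ → Ω → ℂ) (t : ℝ) : Prop :=
  ∀ᵐ ω ∂P, Summable fun l : ℕ => ∑ m ∈ orders l, u l m t ω • harmonic l m

end Wave

/-! ### The spectral approximation, computed recursively on a time grid -/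

/-- `R₁^ℓ(t) = (ℓ(ℓ+1))^{-1/2} sin(t (ℓ(ℓ+1))^{1/2})`, with the limiting value `t` for `ℓ = 0`. -/
noncomputable def R1 (l : ℕ) (t : ℝ) : ℝ :=
  if l = 0 then t else
    Real.sin (t * Real.sqrt ((l : ℝ) * (l + 1))) / Real.sqrt ((l : ℝ) * (l + 1))

/-- `R₂^ℓ(t) = cos(t (ℓ(ℓ+1))^{1/2})`. -/
noncomputable def R2 (l : ℕ) (t : ℝ) : ℝ := Real.cos (t * Real.sqrt ((l : ℝ) * (l + 1)))

/-- The Wiener integral `∫_r^t f(s) dg(s)` of a continuously differentiable deterministic integrand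
`f` along the continuous path `g` (Paley–Wiener–Zygmund; equal to the Riemann–Stieltjes integral
and, for Brownian paths, almost surely to the Itô integral). -/
noncomputable def wienerIntegral (f : ℝ → ℝ) (g : ℝ → ℂ) (r t : ℝ) : ℂ :=
  (f t : ℂ) * g t - (f r : ℂ) * g r - ∫ s in r..t, ((deriv f s : ℝ) : ℂ) * g s

/-- The recursion
`u(t_{j+1}) = (R₂(h), -ℓ(ℓ+1) R₁(h))ᵀ u₁(t_j) + (R₁(h), R₂(h))ᵀ u₂(t_j) + Ŵ`, `h = t_{j+1} - t_j`,
for one pair of coefficients, where `Ŵ = ∫_{t_j}^{t_{j+1}} (R₁, R₂)ᵀ(t_{j+1} - s) da(s)` is the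
increment of the stochastic convolution and `(x₁, x₂)` are the initial coefficients. -/
noncomputable def recursion (l : ℕ) (x₁ x₂ : ℂ) (a : ℝ → ℂ) (τ : ℕ → ℝ) : ℕ → ℂ × ℂ
  | 0 => (x₁, x₂)
  | j + 1 =>
    let U := recursion l x₁ x₂ a τ j
    let h := τ (j + 1) - τ j
    ((R2 l h : ℂ) * U.1 + (R1 l h : ℂ) * U.2
        + wienerIntegral (fun s => R1 l (τ (j + 1) - s)) a (τ j) (τ (j + 1)),
      -((l : ℂ) * (l + 1)) * (R1 l h : ℂ) * U.1 + (R2 l h : ℂ) * U.2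
        + wienerIntegral (fun s => R2 l (τ (j + 1) - s)) a (τ j) (τ (j + 1)))

section Approx

variable {Ω : Type*}

/-- The approximate position `u₁^κ(t_n) = ∑_{ℓ=0}^κ ∑_{m=-ℓ}^ℓ u₁^{ℓ,m}(t_n) Y_{ℓ,m}`, with
coefficients computed by the recursion on the grid `τ = (t_j)`. -/
noncomputable def approxPosition (κ : ℕ) (v₁ v₂ : L2) (a : ℕ → ℤ → ℝ → Ω → ℂ) (τ : ℕ → ℝ) (n : ℕ)
    (ω : Ω) : L2 :=
  ∑ l ∈ Finset.range (κ + 1), ∑ m ∈ orders l,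
    (recursion l (coeff v₁ l m) (coeff v₂ l m) (fun s => a l m s ω) τ n).1 • harmonic l m

/-- The approximate velocity `u₂^κ(t_n) = ∑_{ℓ=0}^κ ∑_{m=-ℓ}^ℓ u₂^{ℓ,m}(t_n) Y_{ℓ,m}`. -/
noncomputable def approxVelocity (κ : ℕ) (v₁ v₂ : L2) (a : ℕ → ℤ → ℝ → Ω → ℂ) (τ : ℕ → ℝ) (n : ℕ)
    (ω : Ω) : L2 :=
  ∑ l ∈ Finset.range (κ + 1), ∑ m ∈ orders l,
    (recursion l (coeff v₁ l m) (coeff v₂ l m) (fun s => a l m s ω) τ n).2 • harmonic l m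

end Approx

end SphereWave

/-! The scheme makes no error in time, so the whole error is the tail of a spectral series. For a
fixed degree and order the wave equation is a linear system of two ordinary equations driven by a
continuous path, and variation of constants holds path by path on every subinterval
(`variation_of_constants`). Each step of the recursion is this formula on one grid cell, so on the
grid the recursion returns the exact coefficients (`recursion_eq_solution`), and the approximation
is almost surely the partial sum of the exact series over degrees at most κ.

Each exact coefficient is a deterministic combination of the initial coefficients plus a Wiener
integral. The latter has mean zero and a second moment bounded as in the Itô isometry. Both facts
come from Riemann–Stieltjes sums: the bound by Fatou's lemma, the mean by refining the partition
(`IsCentredNoise.lintegral_wienerIntegral_le`, `IsCentredNoise.integral_wienerIntegral`).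

The harmonics are orthonormal (`inner_harmonic`), so the degrees span orthogonal subspaces. Hence
the mean of the error is the tail of the deterministic part alone, and the difference of the squared
norms is exactly the squared norm of the tail (`orthogonal_series_truncation`). This is why the
second weak error has twice the rate of the first in the initial data.

It remains to bound tails. With λ = 1 + ℓ(ℓ+1), a Sobolev weight λ^s with s ≥ p turns into the
factor κ^(-2(s-p)) for data measured with weight λ^p (`tsum_eigen_rpow_mul_power_le`). The noise
contributes ∑ (2ℓ+1) A_ℓ λ^p, of order κ^(-(α-2-2p)) by comparison with an integral (`noise_tail`).
Position and velocity are the cases p = -1 and p = 0 of the single estimate `truncation_bounds`. -/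

namespace SphereWave

/-! ### Orthogonality of associated Legendre functions -/

-- Repeated integration by parts; the vanishing of the derivatives of `w` at ±1 removes every
-- boundary term.
open Polynomial in
theorem integral_eval_mul_iterate_derivative (k : ℕ) (p w : ℝ[X])
    (h₁ : ∀ j < k, (derivative^[j] w).eval 1 = 0)
    (h₂ : ∀ j < k, (derivative^[j] w).eval (-1) = 0) :
    ∫ x in (-1 : ℝ)..1, p.eval x * (derivative^[k] w).eval x =
      (-1) ^ k * ∫ x in (-1 : ℝ)..1, (derivative^[k] p).eval x * w.eval x := by
  induction k generalizing p with
  | zero => simp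
  | succ k ih =>
    have key := intervalIntegral.integral_mul_deriv_eq_deriv_mul (a := (-1 : ℝ)) (b := 1)
      (u := fun x => p.eval x) (v := fun x => (derivative^[k] w).eval x)
      (u' := fun x => (derivative p).eval x) (v' := fun x => (derivative^[k + 1] w).eval x)
      (fun x _ => p.hasDerivAt x)
      (fun x _ => by
        rw [Function.iterate_succ_apply']
        exact (derivative^[k] w).hasDerivAt x)
      ((derivative p).continuous.intervalIntegrable _ _)
      ((derivative^[k + 1] w).continuous.intervalIntegrable _ _)
    rw [key, h₁ k (by omega), h₂ k (by omega), ih (derivative p) (fun j hj => h₁ j (by omega))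
      (fun j hj => h₂ j (by omega)), Function.iterate_succ_apply]
    ring

-- Each differentiation costs at most one factor X² - 1, so after fewer than n of them one such
-- factor survives.
open Polynomial in
theorem eval_iterate_derivative_mul_eq_zero {n j : ℕ} (hj : j < n) (r : ℝ[X]) {x : ℝ}
    (hx : x ^ 2 = 1) : (derivative^[j] ((X ^ 2 - 1) ^ n * r)).eval x = 0 := by
  have h := pow_sub_dvd_iterate_derivative_of_pow_dvd (p := (X ^ 2 - 1) ^ n * r)
    (q := (X ^ 2 - 1 : ℝ[X])) (n := n) j (dvd_mul_right _ _)
  have h' : (X ^ 2 - 1 : ℝ[X]) ∣ derivative^[j] ((X ^ 2 - 1) ^ n * r) :=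
    (dvd_pow_self _ (by omega)).trans h
  obtain ⟨s, hs⟩ := h'
  rw [hs, eval_mul]
  simp [hx]

/-- The substitution x = cos ϑ gives the integral of an odd power of the sine, a Wallis product. -/
theorem integral_one_sub_sq_pow (l : ℕ) :
    ∫ x in (-1 : ℝ)..1, (1 - x ^ 2) ^ l =
      2 ^ (2 * l + 1) * (l.factorial : ℝ) ^ 2 / (2 * l + 1).factorial := by
  have h := integral_sin_pow_odd_mul_cos_pow (a := 0) (b := Real.pi) l 0
  simp only [pow_zero, mul_one, one_mul, Real.cos_pi, Real.cos_zero] at h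
  rw [← h, integral_sin_pow_odd]
  induction l with
  | zero => simp
  | succ k ih =>
    -- The substitution identity `h` depends on `l` and travels with the induction, so it is
    -- supplied again for `k`.
    have ih' := ih (by
      have h := integral_sin_pow_odd_mul_cos_pow (a := 0) (b := Real.pi) k 0
      simpa using h)
    rw [Finset.prod_range_succ, ← mul_assoc, ih']
    have e : (2 * (k + 1) + 1).factorial = (2 * k + 3) * ((2 * k + 2) * (2 * k + 1).factorial) := by
      rw [show 2 * (k + 1) + 1 = (2 * k + 1 + 1) + 1 by ring, Nat.factorial_succ,
        Nat.factorial_succ]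
    rw [e, Nat.factorial_succ k]
    have : ((2 * k + 1).factorial : ℝ) ≠ 0 := by positivity
    push_cast
    have h3 : (2 * (k : ℝ) + 3) ≠ 0 := by positivity
    have h2 : (2 * (k : ℝ) + 2) ≠ 0 := by positivity
    field_simp
    ring

open Polynomial in
theorem iterate_derivative_of_natDegree_le {l : ℕ} {q : ℝ[X]} (hq : q.natDegree ≤ l) :
    derivative^[l] q = C (l.factorial * q.coeff l) := by
  ext n
  rw [coeff_iterate_derivative, coeff_C]
  split_ifs with hn
  · subst hn
    simp [Nat.descFactorial_self]
  · rw [coeff_eq_zero_of_natDegree_lt (by omega), smul_zero]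

open Polynomial in
theorem natDegree_sq_sub_one_pow_le (l : ℕ) : ((X ^ 2 - 1 : ℝ[X]) ^ l).natDegree ≤ 2 * l := by
  have h : (X ^ 2 - 1 : ℝ[X]).natDegree ≤ 2 := by compute_degree
  calc _ ≤ l * (X ^ 2 - 1 : ℝ[X]).natDegree := natDegree_pow_le
    _ ≤ l * 2 := by gcongr
    _ = 2 * l := by ring

open Polynomial in
theorem coeff_sq_sub_one_pow (l : ℕ) : ((X ^ 2 - 1 : ℝ[X]) ^ l).coeff (2 * l) = 1 := by
  have h : (X ^ 2 - 1 : ℝ[X]).natDegree ≤ 2 := by compute_degree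
  have := coeff_pow_of_natDegree_le (m := l) h
  rw [mul_comm 2 l, this]
  simp [coeff_one]

theorem legendre_natDegree_le (l : ℕ) : (legendre l).natDegree ≤ l := by
  unfold legendre
  refine (Polynomial.natDegree_C_mul_le _ _).trans ?_
  refine (Polynomial.natDegree_iterate_derivative _ _).trans ?_
  have := natDegree_sq_sub_one_pow_le l
  omega

theorem legendre_coeff (l : ℕ) :
    (legendre l).coeff l = (2 * l).factorial / (2 ^ l * (l.factorial : ℝ) ^ 2) := by
  unfold legendre
  rw [Polynomial.coeff_C_mul, Polynomial.coeff_iterate_derivative, ← two_mul,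
    coeff_sq_sub_one_pow]
  have h : l.factorial * (2 * l).descFactorial l = (2 * l).factorial := by
    have := Nat.factorial_mul_descFactorial (show l ≤ 2 * l by omega)
    rwa [show 2 * l - l = l by omega] at this
  rw [← h]
  have : (l.factorial : ℝ) ≠ 0 := by positivity
  simp only [nsmul_eq_mul, mul_one]
  push_cast
  field_simp

/-- Integrals of Legendre polynomials against polynomials of at most the same degree. -/
theorem integral_legendre_mul {l : ℕ} {q : Polynomial ℝ} (hq : q.natDegree ≤ l) :
    ∫ x in (-1 : ℝ)..1, (legendre l).eval x * q.eval x =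
      q.coeff l * (2 ^ (l + 1) * (l.factorial : ℝ) ^ 2 / (2 * l + 1).factorial) := by
  -- By Rodrigues' formula all l derivatives can be moved onto q, where only the coefficient of
  -- degree l survives.
  have h := integral_eval_mul_iterate_derivative l q ((Polynomial.X ^ 2 - 1) ^ l)
    (fun j hj => by simpa using eval_iterate_derivative_mul_eq_zero hj 1 (x := 1) (by norm_num))
    (fun j hj => by simpa using eval_iterate_derivative_mul_eq_zero hj 1 (x := -1) (by norm_num))
  rw [iterate_derivative_of_natDegree_le hq] at h
  have h1 : ∀ x : ℝ, (legendre l).eval x * q.eval x = (2 ^ l * (l.factorial : ℝ))⁻¹ *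
      (q.eval x * (Polynomial.derivative^[l] ((Polynomial.X ^ 2 - 1) ^ l)).eval x) := by
    intro x
    simp only [legendre, Polynomial.eval_mul, Polynomial.eval_C]
    ring
  have h2 : ∀ x : ℝ, Polynomial.eval x (Polynomial.C (l.factorial * q.coeff l)) *
      Polynomial.eval x ((Polynomial.X ^ 2 - 1) ^ l) =
      ((-1) ^ l * (l.factorial * q.coeff l)) * (1 - x ^ 2) ^ l := by
    intro x
    simp only [Polynomial.eval_C, Polynomial.eval_pow, Polynomial.eval_sub, Polynomial.eval_X,
      Polynomial.eval_one]
    rw [show x ^ 2 - 1 = (-1) * (1 - x ^ 2) by ring, mul_pow]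
    ring
  simp_rw [h1, intervalIntegral.integral_const_mul, h, h2, intervalIntegral.integral_const_mul,
    integral_one_sub_sq_pow]
  have hp : ((-1 : ℝ) ^ l) * (-1) ^ l = 1 := by rw [← mul_pow]; simp
  have h3 : (l.factorial : ℝ) ≠ 0 := by positivity
  have h4 : ((2 * l + 1).factorial : ℝ) ≠ 0 := by positivity
  have h5 : (2 : ℝ) ^ l ≠ 0 := by positivity
  rw [show (-1 : ℝ) ^ l * ((-1) ^ l * (l.factorial * q.coeff l) *
      (2 ^ (2 * l + 1) * (l.factorial : ℝ) ^ 2 / (2 * l + 1).factorial)) =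
      (l.factorial * q.coeff l) *
      (2 ^ (2 * l + 1) * (l.factorial : ℝ) ^ 2 / (2 * l + 1).factorial) by
      linear_combination (l.factorial * q.coeff l) *
      (2 ^ (2 * l + 1) * (l.factorial : ℝ) ^ 2 / (2 * l + 1).factorial) * hp]
  rw [show 2 * l + 1 = l + (l + 1) by ring, pow_add]
  field_simp

open Polynomial in
theorem natDegree_iterate_derivative_legendre_le (l m : ℕ) :
    (derivative^[m] (legendre l)).natDegree ≤ l - m :=
  (natDegree_iterate_derivative _ _).trans (Nat.sub_le_sub_right (legendre_natDegree_le l) m)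

-- The operator q ↦ D^m((X² - 1)^m D^m q) appears when associated Legendre functions are integrated
-- by parts. It does not raise the degree (2m gained, m lost twice), and `coeff_legendre_operator`
-- gives its effect on the leading coefficient, which is all that an integral against a Legendre
-- polynomial sees.
open Polynomial in
theorem natDegree_legendre_operator_le {l m : ℕ} (hm : m ≤ l) :
    (derivative^[m] ((X ^ 2 - 1) ^ m * derivative^[m] (legendre l))).natDegree ≤ l := by
  refine (natDegree_iterate_derivative _ _).trans ?_
  have h1 := natDegree_sq_sub_one_pow_le m
  have h2 := natDegree_iterate_derivative_legendre_le l m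
  have h3 := natDegree_mul_le (p := (X ^ 2 - 1 : ℝ[X]) ^ m) (q := derivative^[m] (legendre l))
  omega

open Polynomial in
theorem coeff_legendre_operator {l m : ℕ} (hm : m ≤ l) :
    (derivative^[m] ((X ^ 2 - 1) ^ m * derivative^[m] (legendre l))).coeff l =
      (l + m).factorial / (l - m).factorial * (legendre l).coeff l := by
  have e : l + m = 2 * m + (l - m) := by omega
  rw [coeff_iterate_derivative]
  have e' : ((X ^ 2 - 1 : ℝ[X]) ^ m * derivative^[m] (legendre l)).coeff (l + m) =
    ((X ^ 2 - 1 : ℝ[X]) ^ m * derivative^[m] (legendre l)).coeff (2 * m + (l - m)) := by rw [e]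
  rw [e', coeff_mul_add_eq_of_natDegree_le (natDegree_sq_sub_one_pow_le m)
    (natDegree_iterate_derivative_legendre_le l m), coeff_sq_sub_one_pow,
    coeff_iterate_derivative, show l - m + m = l by omega]
  have h1 := Nat.factorial_mul_descFactorial (show m ≤ l + m by omega)
  have h2 := Nat.factorial_mul_descFactorial hm
  rw [show l + m - m = l by omega] at h1
  have h3 : ((l - m).factorial : ℝ) ≠ 0 := by positivity
  rw [← h1, ← h2]
  simp only [nsmul_eq_mul, one_mul]
  push_cast
  field_simp

-- Moving m derivatives off the factor of larger degree leaves P_l against a polynomial of degree at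
-- most l' ≤ l. Its coefficient of degree l is zero unless l = l', and otherwise yields the
-- normalization.
open Polynomial in
theorem integral_assocLegendre_mul_of_le {l l' m : ℕ} (hm : m ≤ l') (hl : l' ≤ l) :
    ∫ x in (-1 : ℝ)..1, (1 - x ^ 2) ^ m * (derivative^[m] (legendre l)).eval x *
      (derivative^[m] (legendre l')).eval x =
      if l = l' then 2 / (2 * l + 1) * ((l + m).factorial / (l - m).factorial : ℝ) else 0 := by
  set w := (X ^ 2 - 1 : ℝ[X]) ^ m * derivative^[m] (legendre l') with hw
  have h := integral_eval_mul_iterate_derivative m (legendre l) w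
    (fun j hj => eval_iterate_derivative_mul_eq_zero hj _ (by norm_num))
    (fun j hj => eval_iterate_derivative_mul_eq_zero hj _ (by norm_num))
  rw [integral_legendre_mul ((natDegree_legendre_operator_le hm).trans hl)] at h
  have hp : ((-1 : ℝ) ^ m) * (-1) ^ m = 1 := by rw [← mul_pow]; simp
  have e : ∀ x : ℝ, (1 - x ^ 2) ^ m * (derivative^[m] (legendre l)).eval x *
      (derivative^[m] (legendre l')).eval x =
      (-1) ^ m * ((derivative^[m] (legendre l)).eval x * w.eval x) := by
    intro x
    simp only [hw, eval_mul, eval_pow, eval_sub, eval_X, eval_one]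
    rw [show 1 - x ^ 2 = (-1) * (x ^ 2 - 1) by ring, mul_pow]
    ring
  simp_rw [e, intervalIntegral.integral_const_mul]
  rw [← h]
  split_ifs with hll
  · subst hll
    rw [coeff_legendre_operator hm, legendre_coeff, Nat.factorial_succ]
    have h3 : (l.factorial : ℝ) ≠ 0 := by positivity
    have h4 : ((2 * l).factorial : ℝ) ≠ 0 := by positivity
    have h5 : ((l - m).factorial : ℝ) ≠ 0 := by positivity
    have h6 : (2 : ℝ) * l + 1 ≠ 0 := by positivity
    push_cast
    field_simp
    ring
  · rw [coeff_eq_zero_of_natDegree_lt, zero_mul]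
    exact (natDegree_legendre_operator_le hm).trans_lt (by omega)

open Polynomial in
theorem integral_assocLegendre_mul {l l' m : ℕ} (hm : m ≤ l) (hm' : m ≤ l') :
    ∫ x in (-1 : ℝ)..1, (1 - x ^ 2) ^ m * (derivative^[m] (legendre l)).eval x *
      (derivative^[m] (legendre l')).eval x =
      if l = l' then 2 / (2 * l + 1) * ((l + m).factorial / (l - m).factorial : ℝ) else 0 := by
  rcases le_total l' l with h | h
  · exact integral_assocLegendre_mul_of_le hm' h
  · have := integral_assocLegendre_mul_of_le hm h
    have e : ∀ x : ℝ, (1 - x ^ 2) ^ m * (derivative^[m] (legendre l)).eval x *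
        (derivative^[m] (legendre l')).eval x = (1 - x ^ 2) ^ m *
        (derivative^[m] (legendre l')).eval x * (derivative^[m] (legendre l)).eval x :=
      fun x => mul_right_comm _ _ _
    simp_rw [e, this]
    by_cases e : l = l'
    · subst e; rfl
    · rw [if_neg (Ne.symm e), if_neg e]

/-! ### Orthonormality of the spherical harmonics -/

/-- Fubini in angular coordinates. The factorization is asked only on the parameter rectangle
because the associated Legendre form of the harmonics needs sin ϑ ≥ 0. -/
theorem integral_surfaceMeasure_of_product {f : S2 → ℂ} (hf : Continuous f) (g h : ℝ → ℂ)
    (hfg : ∀ p ∈ Set.Icc 0 Real.pi ×ˢ Set.Ico 0 (2 * Real.pi), f (angularPoint p) = g p.1 * h p.2) :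
    ∫ y, f y ∂surfaceMeasure =
      (∫ ϑ in (0 : ℝ)..Real.pi, Real.sin ϑ * g ϑ) * ∫ φ in (0 : ℝ)..2 * Real.pi, h φ := by
  have hms : MeasurableSet (Set.Icc 0 Real.pi ×ˢ Set.Ico 0 (2 * Real.pi)) :=
    measurableSet_Icc.prod measurableSet_Ico
  rw [surfaceMeasure, integral_map continuous_angularPoint.measurable.aemeasurable
    hf.aestronglyMeasurable, angularMeasure,
    integral_withDensity_eq_integral_toReal_smul (by fun_prop)
      (Filter.Eventually.of_forall fun _ => ENNReal.ofReal_lt_top),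
    setIntegral_congr_fun (g := fun p : ℝ × ℝ => (Real.sin p.1 * g p.1 : ℂ) * h p.2) hms,
    Measure.volume_eq_prod, setIntegral_prod_mul (fun ϑ => (Real.sin ϑ * g ϑ : ℂ)) h,
    integral_Icc_eq_integral_Ioc, integral_Ico_eq_integral_Ioc,
    intervalIntegral.integral_of_le Real.pi_pos.le,
    intervalIntegral.integral_of_le Real.two_pi_pos.le]
  intro p hp
  simp only
  rw [hfg p hp, ENNReal.toReal_ofReal (Real.sin_nonneg_of_mem_Icc hp.1), Complex.real_smul]
  ring

theorem harmonicFun_angularPoint (l : ℕ) (m : ℤ) {ϑ : ℝ} (h : ϑ ∈ Set.Icc 0 Real.pi) (φ : ℝ) :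
    harmonicFun l m (angularPoint (ϑ, φ)) = (if 0 ≤ m then 1 else (-1) ^ m.natAbs) *
      ((harmonicNorm l m.natAbs : ℂ) * (assocLegendre l m.natAbs (Real.cos ϑ) : ℂ)) *
        Complex.exp (Complex.I * m * φ) := by
  rw [harmonicFun, harmonicNonneg_angularPoint l _ h]
  split_ifs with hm
  · have : ((m.natAbs : ℕ) : ℂ) = (m : ℂ) := by
      rw [← Int.cast_natCast, Int.natAbs_of_nonneg hm]
    rw [this]
    ring
  · have : ((m.natAbs : ℕ) : ℂ) = -(m : ℂ) := by
      rw [← Int.cast_natCast, Int.ofNat_natAbs_of_nonpos (not_le.1 hm).le, Int.cast_neg]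
    rw [this, map_mul, map_mul, Complex.conj_ofReal, Complex.conj_ofReal, ← Complex.exp_conj]
    simp only [map_mul, map_neg, Complex.conj_I, Complex.conj_ofReal, map_intCast]
    rw [show -Complex.I * -(m : ℂ) * (φ : ℂ) = Complex.I * m * φ by ring]
    ring

theorem integral_exp_int (k : ℤ) :
    ∫ φ in (0 : ℝ)..2 * Real.pi, Complex.exp (Complex.I * k * φ) =
      if k = 0 then (2 * Real.pi : ℂ) else 0 := by
  split_ifs with hk
  · simp [hk]
  · have hc : Complex.I * k ≠ 0 := mul_ne_zero Complex.I_ne_zero (by exact_mod_cast hk)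
    rw [integral_exp_mul_complex hc]
    have : Complex.I * k * ((2 * Real.pi : ℝ) : ℂ) = k * (2 * Real.pi * Complex.I) := by
      push_cast; ring
    rw [this, Complex.exp_int_mul_two_pi_mul_I]
    simp

theorem integral_sin_mul_assocLegendre {l l' m : ℕ} (hm : m ≤ l) (hm' : m ≤ l') :
    ∫ ϑ in (0 : ℝ)..Real.pi, Real.sin ϑ *
      (assocLegendre l m (Real.cos ϑ) * assocLegendre l' m (Real.cos ϑ)) =
      if l = l' then 2 / (2 * l + 1) * ((l + m).factorial / (l - m).factorial : ℝ) else 0 := by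
  have h := intervalIntegral.integral_comp_mul_deriv (a := 0) (b := Real.pi) (f := Real.cos)
    (f' := fun x => -Real.sin x)
    (g := fun x => (1 - x ^ 2) ^ m * (Polynomial.derivative^[m] (legendre l)).eval x *
      (Polynomial.derivative^[m] (legendre l')).eval x) (fun x _ => Real.hasDerivAt_cos x)
    (by fun_prop) (by fun_prop)
  rw [Real.cos_zero, Real.cos_pi, intervalIntegral.integral_symm (-1) 1,
    integral_assocLegendre_mul hm hm'] at h
  rw [← neg_eq_iff_eq_neg] at h
  rw [← h, ← intervalIntegral.integral_neg]
  refine intervalIntegral.integral_congr fun ϑ hϑ => ?_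
  rw [Set.uIcc_of_le Real.pi_pos.le] at hϑ
  have hs : 0 ≤ Real.sin ϑ := Real.sin_nonneg_of_mem_Icc hϑ
  have h1 : (1 - Real.cos ϑ ^ 2) ^ ((m : ℝ) / 2) = Real.sin ϑ ^ m := by
    rw [← Real.sin_sq, ← Real.rpow_natCast (Real.sin ϑ) 2, ← Real.rpow_mul hs,
      ← Real.rpow_natCast (Real.sin ϑ) m]
    congr 1
    push_cast
    ring
  have hp : ((-1 : ℝ) ^ m) * (-1) ^ m = 1 := by rw [← mul_pow]; simp
  simp only [assocLegendre, Function.comp, h1]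
  rw [← Real.sin_sq, ← pow_mul, mul_comm 2 m, pow_mul]
  linear_combination (Real.sin ϑ * (Real.sin ϑ ^ m) ^ 2 *
    (Polynomial.derivative^[m] (legendre l)).eval (Real.cos ϑ) *
      (Polynomial.derivative^[m] (legendre l')).eval (Real.cos ϑ)) * hp

theorem inner_harmonic (l l' : ℕ) {m m' : ℤ} (hm : m ∈ orders l) (hm' : m' ∈ orders l') :
    inner ℂ (harmonic l m) (harmonic l' m') = if l = l' ∧ m = m' then 1 else 0 := by
  rw [Finset.mem_Icc] at hm hm'
  rw [harmonic, harmonic, ContinuousMap.inner_toLp]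
  -- The sign from the convention for negative orders. Unequal orders are killed by the azimuthal
  -- integral, so only `ε m * ε m = 1` ever matters.
  set ε : ℤ → ℝ := fun m => if 0 ≤ m then 1 else (-1) ^ m.natAbs with hε
  have hε2 : ∀ m, ε m * ε m = 1 := by
    intro m
    simp only [hε]
    split_ifs
    · simp
    · rw [← mul_pow]; simp
  have hεC : ∀ m, (if 0 ≤ m then 1 else (-1) ^ m.natAbs : ℂ) = (ε m : ℂ) := by
    intro m
    simp only [hε]
    split_ifs <;> simp
  have key := integral_surfaceMeasure_of_product
    (f := fun y => harmonicFun l' m' y * (starRingEnd ℂ) (harmonicFun l m y))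
    ((continuous_harmonicFun l' m').mul
      (Complex.continuous_conj.comp (continuous_harmonicFun l m)))
    (fun ϑ => ((ε m * ε m' * harmonicNorm l m.natAbs * harmonicNorm l' m'.natAbs *
      (assocLegendre l m.natAbs (Real.cos ϑ) * assocLegendre l' m'.natAbs (Real.cos ϑ)) : ℝ) : ℂ))
    (fun φ => Complex.exp (Complex.I * (m' - m : ℤ) * φ))
    (by
      rintro ⟨ϑ, φ⟩ hp
      simp only
      rw [harmonicFun_angularPoint l m hp.1, harmonicFun_angularPoint l' m' hp.1, hεC, hεC]
      simp only [map_mul, Complex.conj_ofReal, ← Complex.exp_conj, Complex.conj_I, map_intCast]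
      rw [show Complex.I * (m' - m : ℤ) * (φ : ℂ) = Complex.I * m' * φ + -Complex.I * m * φ by
        push_cast; ring, Complex.exp_add]
      push_cast
      ring)
  simp only [ContinuousMap.coe_mk]
  rw [key, integral_exp_int]
  by_cases hmm : m = m'
  · subst hmm
    have e : ∀ ϑ : ℝ, (Real.sin ϑ : ℂ) * ((ε m * ε m * harmonicNorm l m.natAbs *
        harmonicNorm l' m.natAbs * (assocLegendre l m.natAbs (Real.cos ϑ) *
          assocLegendre l' m.natAbs (Real.cos ϑ)) : ℝ) : ℂ) =
        ((harmonicNorm l m.natAbs * harmonicNorm l' m.natAbs * (Real.sin ϑ *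
          (assocLegendre l m.natAbs (Real.cos ϑ) *
          assocLegendre l' m.natAbs (Real.cos ϑ))) : ℝ) : ℂ) := by
      intro ϑ
      rw [hε2]
      push_cast
      ring
    simp_rw [e]
    rw [intervalIntegral.integral_ofReal, intervalIntegral.integral_const_mul,
      integral_sin_mul_assocLegendre (by omega) (by omega)]
    simp only [sub_self, if_true, and_true]
    split_ifs with hl
    · subst hl
      have h0 : 0 ≤ (2 * (l : ℝ) + 1) / (4 * Real.pi) *
          ((l - m.natAbs).factorial / (l + m.natAbs).factorial) := by positivity
      rw [harmonicNorm, Real.mul_self_sqrt h0]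
      have h1 : ((l - m.natAbs).factorial : ℝ) ≠ 0 := by positivity
      have h2 : ((l + m.natAbs).factorial : ℝ) ≠ 0 := by positivity
      have h3 : 2 * (l : ℝ) + 1 ≠ 0 := by positivity
      have h4 := Real.pi_ne_zero
      rw [show (2 * Real.pi : ℂ) = ((2 * Real.pi : ℝ) : ℂ) by push_cast; rfl,
        ← Complex.ofReal_mul, ← Complex.ofReal_one]
      congr 1
      field_simp
      norm_num
    · simp
  · rw [if_neg (by omega), mul_zero, if_neg (by tauto)]

/-- The space of spherical harmonics of degree `l`. -/
noncomputable def harmonicSpace (l : ℕ) : Submodule ℂ L2 :=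
  Submodule.span ℂ (harmonic l '' (orders l : Set ℤ))

/-- The series in `field` is summed degree by degree; one subspace per degree lets the abstract
results on orthogonal series apply to it. -/
theorem orthogonalFamily_harmonicSpace :
    OrthogonalFamily ℂ (fun l => harmonicSpace l) fun l => (harmonicSpace l).subtypeₗᵢ := by
  refine OrthogonalFamily.of_pairwise fun l l' hl => ?_
  simp only [Function.onFun, harmonicSpace]
  rw [Submodule.isOrtho_span]
  rintro _ ⟨m, hm, rfl⟩ _ ⟨m', hm', rfl⟩
  rw [inner_harmonic l l' hm hm', if_neg (fun h => hl h.1)]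

theorem sum_smul_harmonic_mem (l : ℕ) (c : ℤ → ℂ) :
    ∑ m ∈ orders l, c m • harmonic l m ∈ harmonicSpace l :=
  Submodule.sum_mem _ fun m hm =>
    Submodule.smul_mem _ _ (Submodule.subset_span ⟨m, hm, rfl⟩)

theorem norm_sq_sum_smul_harmonic (l : ℕ) (c : ℤ → ℂ) :
    ‖∑ m ∈ orders l, c m • harmonic l m‖ ^ 2 = ∑ m ∈ orders l, ‖c m‖ ^ 2 := by
  have h : (inner ℂ (∑ m ∈ orders l, c m • harmonic l m)
      (∑ m ∈ orders l, c m • harmonic l m) : ℂ) = ((∑ m ∈ orders l, ‖c m‖ ^ 2 : ℝ) : ℂ) := by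
    rw [sum_inner]
    push_cast
    refine Finset.sum_congr rfl fun m hm => ?_
    rw [inner_sum, Finset.sum_eq_single_of_mem m hm]
    · rw [inner_smul_left, inner_smul_right, inner_harmonic l l hm hm, if_pos ⟨rfl, rfl⟩, mul_one,
        ← Complex.conj_mul']
    · intro m' hm' hne
      rw [inner_smul_left, inner_smul_right, inner_harmonic l l hm hm',
        if_neg (fun h => hne h.2.symm), mul_zero, mul_zero]
  rw [@norm_sq_eq_re_inner ℂ, h]
  rfl

/-! ### Random series in orthogonal subspaces -/

section SecondMoments

variable {Ω E : Type*} [MeasurableSpace Ω] {P : Measure Ω} [NormedAddCommGroup E]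

theorem enorm_sq_eq_ofReal (x : E) : ‖x‖ₑ ^ 2 = ENNReal.ofReal (‖x‖ ^ 2) := by
  rw [ENNReal.ofReal_pow (norm_nonneg x), ofReal_norm]

theorem eLpNorm_two_eq (f : Ω → E) :
    eLpNorm f 2 P = (∫⁻ ω, ‖f ω‖ₑ ^ 2 ∂P) ^ (1 / 2 : ℝ) := by
  rw [eLpNorm_eq_lintegral_rpow_enorm_toReal (by norm_num) (by norm_num)]
  simp

/-- Second moments are bounded throughout as extended nonnegative integrals: such a bound
presupposes no integrability and then delivers it. -/
theorem memLp_two_of_lintegral_le {f : Ω → E} (hf : AEStronglyMeasurable f P) {s : ℝ}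
    (h : ∫⁻ ω, ‖f ω‖ₑ ^ 2 ∂P ≤ ENNReal.ofReal s) : MemLp f 2 P := by
  refine ⟨hf, ?_⟩
  rw [eLpNorm_two_eq]
  exact ENNReal.rpow_lt_top_of_nonneg (by norm_num) (h.trans_lt ENNReal.ofReal_lt_top).ne

theorem integral_norm_sq_le {f : Ω → E} {s : ℝ} (hs : 0 ≤ s) (hf : AEStronglyMeasurable f P)
    (h : ∫⁻ ω, ‖f ω‖ₑ ^ 2 ∂P ≤ ENNReal.ofReal s) : ∫ ω, ‖f ω‖ ^ 2 ∂P ≤ s := by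
  rw [integral_eq_lintegral_of_nonneg_ae (Filter.Eventually.of_forall fun ω => by positivity)
    (hf.norm.aemeasurable.pow_const 2).aestronglyMeasurable]
  simp_rw [← enorm_sq_eq_ofReal]
  exact ENNReal.toReal_le_of_le_ofReal hs h

/-- On a probability space the norm of the mean is at most the L¹ norm, hence at most the L² norm.
-/
theorem norm_integral_sq_le [NormedSpace ℝ E] [IsProbabilityMeasure P] {f : Ω → E} {s : ℝ}
    (hs : 0 ≤ s) (hf : AEStronglyMeasurable f P)
    (h : ∫⁻ ω, ‖f ω‖ₑ ^ 2 ∂P ≤ ENNReal.ofReal s) : ‖∫ ω, f ω ∂P‖ ^ 2 ≤ s := by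
  have h1 : ‖∫ ω, f ω ∂P‖ₑ ≤ (∫⁻ ω, ‖f ω‖ₑ ^ 2 ∂P) ^ (1 / 2 : ℝ) := by
    rw [← eLpNorm_two_eq]
    refine (enorm_integral_le_lintegral_enorm _).trans ?_
    rw [← eLpNorm_one_eq_lintegral_enorm]
    exact eLpNorm_le_eLpNorm_of_exponent_le (by norm_num) hf
  have h2 : ‖∫ ω, f ω ∂P‖ₑ ^ 2 ≤ ENNReal.ofReal s := by
    refine le_trans (pow_le_pow_left' h1 2) ?_
    rw [← ENNReal.rpow_natCast, ← ENNReal.rpow_mul]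
    simpa using h
  rw [enorm_sq_eq_ofReal] at h2
  exact (ENNReal.ofReal_le_ofReal_iff hs).1 h2

theorem lintegral_enorm_sq_add_le {f g : Ω → E} {s t : ℝ} (hs : 0 ≤ s) (ht : 0 ≤ t)
    (hf : AEStronglyMeasurable f P)
    (h : ∫⁻ ω, ‖f ω‖ₑ ^ 2 ∂P ≤ ENNReal.ofReal s) (h' : ∫⁻ ω, ‖g ω‖ₑ ^ 2 ∂P ≤ ENNReal.ofReal t) :
    ∫⁻ ω, ‖f ω + g ω‖ₑ ^ 2 ∂P ≤ ENNReal.ofReal (2 * (s + t)) := by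
  calc ∫⁻ ω, ‖f ω + g ω‖ₑ ^ 2 ∂P
      ≤ ∫⁻ ω, (2 * ‖f ω‖ₑ ^ 2 + 2 * ‖g ω‖ₑ ^ 2) ∂P := by
        refine lintegral_mono fun ω => ?_
        simp only [enorm_sq_eq_ofReal]
        rw [← ENNReal.ofReal_ofNat 2, ← ENNReal.ofReal_mul (by norm_num),
          ← ENNReal.ofReal_mul (by norm_num),
          ← ENNReal.ofReal_add (by positivity) (by positivity)]
        refine ENNReal.ofReal_le_ofReal ?_
        have := norm_add_le (f ω) (g ω)
        have h0 := norm_nonneg (f ω + g ω)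
        nlinarith [sq_nonneg (‖f ω‖ - ‖g ω‖)]
    _ = 2 * ∫⁻ ω, ‖f ω‖ₑ ^ 2 ∂P + 2 * ∫⁻ ω, ‖g ω‖ₑ ^ 2 ∂P := by
        rw [lintegral_add_left' ((hf.enorm.pow_const 2).const_mul 2),
          lintegral_const_mul' _ _ (by norm_num), lintegral_const_mul' _ _ (by norm_num)]
    _ ≤ 2 * ENNReal.ofReal s + 2 * ENNReal.ofReal t := by gcongr
    _ = ENNReal.ofReal (2 * (s + t)) := by
        rw [← mul_add, ← ENNReal.ofReal_add hs ht, ENNReal.ofReal_mul (by norm_num),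
          ENNReal.ofReal_ofNat]

end SecondMoments

section OrthogonalSeries

variable {H : Type*} [NormedAddCommGroup H] [InnerProductSpace ℂ H]
  {V : ℕ → Submodule ℂ H}

theorem norm_sq_sum_of_orthogonal
    (hV : OrthogonalFamily ℂ (fun l => V l) fun l => (V l).subtypeₗᵢ) {z : ℕ → H}
    (hz : ∀ l, z l ∈ V l) (s : Finset ℕ) : ‖∑ l ∈ s, z l‖ ^ 2 = ∑ l ∈ s, ‖z l‖ ^ 2 :=
  hV.norm_sum (fun l => ⟨z l, hz l⟩) s

theorem norm_sq_tsum_of_orthogonal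
    (hV : OrthogonalFamily ℂ (fun l => V l) fun l => (V l).subtypeₗᵢ) {z : ℕ → H}
    (hz : ∀ l, z l ∈ V l) (hs : Summable z) : ‖∑' l, z l‖ ^ 2 = ∑' l, ‖z l‖ ^ 2 := by
  have h1 : HasSum (fun l => ‖z l‖ ^ 2) (‖∑' l, z l‖ ^ 2) := by
    have h2 := (Filter.Tendsto.norm hs.hasSum).pow 2
    simp only [norm_sq_sum_of_orthogonal hV hz] at h2
    exact h2
  exact h1.tsum_eq.symm

/-- A tail is again an orthogonal series, so each result on full series also serves for tails. -/
theorem orthogonalFamily_shift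
    (hV : OrthogonalFamily ℂ (fun l => V l) fun l => (V l).subtypeₗᵢ) (k : ℕ) :
    OrthogonalFamily ℂ (fun l => V (l + k)) fun l => (V (l + k)).subtypeₗᵢ :=
  hV.comp (f := fun l => l + k) (add_left_injective k)

variable [CompleteSpace H]

theorem summable_iff_of_orthogonal
    (hV : OrthogonalFamily ℂ (fun l => V l) fun l => (V l).subtypeₗᵢ) {z : ℕ → H}
    (hz : ∀ l, z l ∈ V l) : Summable z ↔ Summable fun l => ‖z l‖ ^ 2 :=
  hV.summable_iff_norm_sq_summable (fun l => ⟨z l, hz l⟩)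

variable {Ω : Type*} [MeasurableSpace Ω] {P : Measure Ω}

/-- An `L²`-bounded random series with terms in orthogonal subspaces converges almost surely. -/
theorem orthogonal_series_converges
    (hV : OrthogonalFamily ℂ (fun l => V l) fun l => (V l).subtypeₗᵢ) {N : ℕ → Ω → H}
    (hN : ∀ l ω, N l ω ∈ V l) (hm : ∀ l, AEStronglyMeasurable (N l) P) {s : ℕ → ℝ}
    (hs0 : ∀ l, 0 ≤ s l) (hs : ∀ l, ∫⁻ ω, ‖N l ω‖ₑ ^ 2 ∂P ≤ ENNReal.ofReal (s l))
    (hsum : Summable s) :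
    (∀ᵐ ω ∂P, Summable fun l => N l ω) ∧ AEStronglyMeasurable (fun ω => ∑' l, N l ω) P ∧
      ∫⁻ ω, ‖∑' l, N l ω‖ₑ ^ 2 ∂P ≤ ENNReal.ofReal (∑' l, s l) := by
  -- Tonelli makes the sum of squared norms integrable, hence finite almost surely, which for
  -- orthogonal terms is convergence of the series.
  have hint : ∫⁻ ω, ∑' l, ‖N l ω‖ₑ ^ 2 ∂P ≤ ENNReal.ofReal (∑' l, s l) := by
    rw [lintegral_tsum fun l => (hm l).enorm.pow_const 2, ENNReal.ofReal_tsum_of_nonneg hs0 hsum]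
    exact ENNReal.tsum_le_tsum hs
  have hae : ∀ᵐ ω ∂P, Summable fun l => N l ω := by
    have h := ae_lt_top' (AEMeasurable.tsum fun l => (hm l).enorm.pow_const 2)
      (hint.trans_lt ENNReal.ofReal_lt_top).ne
    filter_upwards [h] with ω hω
    rw [summable_iff_of_orthogonal hV fun l => hN l ω]
    have := ENNReal.summable_toReal hω.ne
    simpa using this
  refine ⟨hae, ?_, ?_⟩
  · refine aestronglyMeasurable_of_tendsto_ae Filter.atTop
      (f := fun n ω => ∑ l ∈ Finset.range n, N l ω)
      (fun n => Finset.aestronglyMeasurable_fun_sum _ fun l _ => hm l) ?_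
    filter_upwards [hae] with ω hω using hω.hasSum.tendsto_sum_nat
  · refine le_trans (lintegral_mono_ae ?_) hint
    filter_upwards [hae] with ω hω
    rw [enorm_sq_eq_ofReal, norm_sq_tsum_of_orthogonal hV (fun l => hN l ω) hω,
      ENNReal.ofReal_tsum_of_nonneg (fun l => by positivity)
        ((summable_iff_of_orthogonal hV fun l => hN l ω).1 hω)]
    simp_rw [enorm_sq_eq_ofReal]
    exact le_rfl

/-- The mean of the sum equals the mean of each of its tails, since finitely many centred terms can
be dropped; the second moments of the tails tend to zero. -/
theorem integral_orthogonal_series_eq_zero [IsProbabilityMeasure P]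
    (hV : OrthogonalFamily ℂ (fun l => V l) fun l => (V l).subtypeₗᵢ) {N : ℕ → Ω → H}
    (hN : ∀ l ω, N l ω ∈ V l) (hm : ∀ l, AEStronglyMeasurable (N l) P) {s : ℕ → ℝ}
    (hs0 : ∀ l, 0 ≤ s l) (hs : ∀ l, ∫⁻ ω, ‖N l ω‖ₑ ^ 2 ∂P ≤ ENNReal.ofReal (s l))
    (hsum : Summable s) (h0 : ∀ l, ∫ ω, N l ω ∂P = 0) : ∫ ω, ∑' l, N l ω ∂P = 0 := by
  obtain ⟨hae, hmeas, hbd⟩ := orthogonal_series_converges hV hN hm hs0 hs hsum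
  have hi : ∀ l, Integrable (N l) P := fun l =>
    (memLp_two_of_lintegral_le (hm l) (hs l)).integrable (by norm_num)
  have hi' := (memLp_two_of_lintegral_le hmeas hbd).integrable (by norm_num)
  have key : ∀ k, ‖∫ ω, ∑' l, N l ω ∂P‖ ^ 2 ≤ ∑' l, s (l + k) := by
    intro k
    have hk := orthogonal_series_converges (orthogonalFamily_shift hV k)
      (fun l ω => hN (l + k) ω) (fun l => hm (l + k)) (fun l => hs0 (l + k))
      (fun l => hs (l + k)) ((summable_nat_add_iff k).2 hsum)
    have e : ∫ ω, ∑' l, N l ω ∂P = ∫ ω, ∑' l, N (l + k) ω ∂P := by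
      have e1 : ∫ ω, ∑' l, N l ω ∂P =
          ∫ ω, (∑ l ∈ Finset.range k, N l ω + ∑' l, N (l + k) ω) ∂P := by
        refine integral_congr_ae ?_
        filter_upwards [hae] with ω hω
        exact (hω.sum_add_tsum_nat_add k).symm
      rw [e1, integral_add (integrable_finsetSum _ fun l _ => hi l)
        ((memLp_two_of_lintegral_le hk.2.1 hk.2.2).integrable (by norm_num)),
        integral_finsetSum _ fun l _ => hi l]
      simp [h0]
    rw [e]
    exact norm_integral_sq_le (tsum_nonneg fun l => hs0 _) hk.2.1 hk.2.2
  have hlim := tendsto_sum_nat_add s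
  have := ge_of_tendsto' hlim key
  have h2 : ‖∫ ω, ∑' l, N l ω ∂P‖ ^ 2 = 0 := le_antisymm this (by positivity)
  simpa using h2

/-- Truncation of a random orthogonal series with deterministic part `D` and centred part `N`. -/
theorem orthogonal_series_truncation [IsProbabilityMeasure P]
    (hV : OrthogonalFamily ℂ (fun l => V l) fun l => (V l).subtypeₗᵢ) {D : ℕ → H} {N : ℕ → Ω → H}
    (hD : ∀ l, D l ∈ V l) (hDs : Summable fun l => ‖D l‖ ^ 2)
    (hN : ∀ l ω, N l ω ∈ V l) (hm : ∀ l, AEStronglyMeasurable (N l) P) {s : ℕ → ℝ}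
    (hs0 : ∀ l, 0 ≤ s l) (hs : ∀ l, ∫⁻ ω, ‖N l ω‖ₑ ^ 2 ∂P ≤ ENNReal.ofReal (s l))
    (hsum : Summable s) (h0 : ∀ l, ∫ ω, N l ω ∂P = 0) (k : ℕ) :
    (∀ᵐ ω ∂P, Summable fun l => D l + N l ω) ∧
    MemLp (fun ω => ∑' l, (D l + N l ω)) 2 P ∧
    MemLp (fun ω => ∑ l ∈ Finset.range k, (D l + N l ω)) 2 P ∧
    ‖∫ ω, (∑' l, (D l + N l ω) - ∑ l ∈ Finset.range k, (D l + N l ω)) ∂P‖ ≤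
      Real.sqrt (∑' l, ‖D (l + k)‖ ^ 2) ∧
    |∫ ω, (‖∑' l, (D l + N l ω)‖ ^ 2 - ‖∑ l ∈ Finset.range k, (D l + N l ω)‖ ^ 2) ∂P| ≤
      2 * (∑' l, ‖D (l + k)‖ ^ 2 + ∑' l, s (l + k)) := by
  have hDsum : Summable D := (summable_iff_of_orthogonal hV hD).2 hDs
  obtain ⟨hae, hmeas, hbd⟩ := orthogonal_series_converges hV hN hm hs0 hs hsum
  obtain ⟨-, hmk, hbk⟩ := orthogonal_series_converges (orthogonalFamily_shift hV k)
      (fun l ω => hN (l + k) ω) (fun l => hm (l + k)) (fun l => hs0 (l + k))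
      (fun l => hs (l + k)) ((summable_nat_add_iff k).2 hsum)
  have hzk := integral_orthogonal_series_eq_zero (orthogonalFamily_shift hV k)
      (fun l ω => hN (l + k) ω) (fun l => hm (l + k)) (fun l => hs0 (l + k))
      (fun l => hs (l + k)) ((summable_nat_add_iff k).2 hsum) (fun l => h0 (l + k))
  have hNk := memLp_two_of_lintegral_le hmk hbk
  have hZ : ∀ᵐ ω ∂P, Summable fun l => D l + N l ω := by
    filter_upwards [hae] with ω hω using hDsum.add hω
  have htail : ∀ᵐ ω ∂P, ∑' l, (D l + N l ω) - ∑ l ∈ Finset.range k, (D l + N l ω) =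
      ∑' l, D (l + k) + ∑' l, N (l + k) ω := by
    filter_upwards [hae] with ω hω
    rw [← (hDsum.add hω).sum_add_tsum_nat_add k, add_sub_cancel_left]
    exact ((summable_nat_add_iff k).2 hDsum).tsum_add ((summable_nat_add_iff k).2 hω)
  have hnD : ‖∑' l, D (l + k)‖ ^ 2 = ∑' l, ‖D (l + k)‖ ^ 2 :=
    norm_sq_tsum_of_orthogonal (orthogonalFamily_shift hV k) (fun l => hD _)
      ((summable_nat_add_iff k).2 hDsum)
  refine ⟨hZ, ?_, ?_, ?_, ?_⟩
  · have hN2 := memLp_two_of_lintegral_le hmeas hbd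
    have h1 := (memLp_const (μ := P) (p := 2) (∑' l, D l)).add hN2
    refine h1.ae_eq ?_
    filter_upwards [hae] with ω hω
    rw [Pi.add_apply]
    exact (hDsum.tsum_add hω).symm
  · have h1 : ∀ l, MemLp (fun ω => D l + N l ω) 2 P := fun l =>
      (memLp_const (D l)).add (memLp_two_of_lintegral_le (hm l) (hs l))
    exact memLp_finsetSum (f := fun l ω => D l + N l ω) _ fun l _ => h1 l
  · rw [integral_congr_ae htail, integral_add (integrable_const _)
      (hNk.integrable (by norm_num)), hzk, add_zero, integral_const, probReal_univ, one_smul,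
      ← hnD, Real.sqrt_sq (norm_nonneg _)]
  -- By Pythagoras there is no cross term between partial sum and tail. The factor 2 in the bound
  -- comes afterwards, from separating the deterministic and the centred part of the tail.
  · have hsq : ∀ᵐ ω ∂P, ‖∑' l, (D l + N l ω)‖ ^ 2 - ‖∑ l ∈ Finset.range k, (D l + N l ω)‖ ^ 2 =
        ‖∑' l, D (l + k) + ∑' l, N (l + k) ω‖ ^ 2 := by
      filter_upwards [htail, hZ] with ω hω hω'
      have hmem : ∀ l, D l + N l ω ∈ V l := fun l => (V l).add_mem (hD l) (hN l ω)
      have hsq := (summable_iff_of_orthogonal hV hmem).1 hω'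
      rw [← hω, norm_sq_tsum_of_orthogonal hV hmem hω', norm_sq_sum_of_orthogonal hV hmem,
        ← hω'.sum_add_tsum_nat_add k, add_sub_cancel_left,
        norm_sq_tsum_of_orthogonal (orthogonalFamily_shift hV k) (fun l => hmem _)
          ((summable_nat_add_iff k).2 hω'), ← hsq.sum_add_tsum_nat_add k, add_sub_cancel_left]
    rw [integral_congr_ae hsq, abs_of_nonneg (integral_nonneg fun ω => by positivity)]
    have hp1 : 0 ≤ ∑' l, ‖D (l + k)‖ ^ 2 := tsum_nonneg fun l => by positivity
    have hp2 : 0 ≤ ∑' l, s (l + k) := tsum_nonneg fun l => hs0 _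
    refine integral_norm_sq_le (by positivity) (aestronglyMeasurable_const.add hmk) ?_
    refine lintegral_enorm_sq_add_le hp1 hp2 aestronglyMeasurable_const ?_ hbk
    rw [lintegral_const, measure_univ, mul_one, enorm_sq_eq_ofReal, hnD]

end OrthogonalSeries

/-! ### Wiener integrals along paths -/

/-- The `i`-th point of the partition of `[r, t]` into `n + 1` intervals of equal length. -/
noncomputable def gridPoint (r t : ℝ) (n i : ℕ) : ℝ := r + i * ((t - r) / (n + 1))

theorem gridPoint_zero (r t : ℝ) (n : ℕ) : gridPoint r t n 0 = r := by simp [gridPoint]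

theorem gridPoint_last (r t : ℝ) (n : ℕ) : gridPoint r t n (n + 1) = t := by
  have : (n : ℝ) + 1 ≠ 0 := by positivity
  simp only [gridPoint]
  push_cast
  field_simp
  ring

theorem gridPoint_succ_sub (r t : ℝ) (n i : ℕ) :
    gridPoint r t n (i + 1) - gridPoint r t n i = (t - r) / (n + 1) := by
  simp only [gridPoint]
  push_cast
  ring

theorem monotone_gridPoint {r t : ℝ} (h : r ≤ t) (n : ℕ) : Monotone (gridPoint r t n) := by
  refine monotone_nat_of_le_succ fun i => ?_
  have h1 := gridPoint_succ_sub r t n i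
  have : 0 ≤ (t - r) / (n + 1) := div_nonneg (by linarith) (by positivity)
  linarith

theorem gridPoint_mem {r t : ℝ} (h : r ≤ t) {n i : ℕ} (hi : i ≤ n + 1) :
    gridPoint r t n i ∈ Set.Icc r t := by
  constructor
  · simpa [gridPoint_zero] using monotone_gridPoint h n (Nat.zero_le i)
  · simpa [gridPoint_last] using monotone_gridPoint h n hi

/-- Abel summation, the discrete counterpart of the formula defining `wienerIntegral`. The boundary
terms agree exactly, so only the last sum has to be compared with an integral. -/
theorem sum_mul_sub_by_parts (f g : ℕ → ℂ) (n : ℕ) :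
    ∑ i ∈ Finset.range n, f i * (g (i + 1) - g i) =
      f n * g n - f 0 * g 0 - ∑ i ∈ Finset.range n, (f (i + 1) - f i) * g (i + 1) := by
  induction n with
  | zero => simp
  | succ n ih =>
    rw [Finset.sum_range_succ, Finset.sum_range_succ, ih]
    ring

theorem continuous_deriv_ofReal_mul {f : ℝ → ℝ} (hf : ContDiff ℝ 1 f) {g : ℝ → ℂ}
    (hg : Continuous g) : Continuous fun s => ((deriv f s : ℝ) : ℂ) * g s :=
  (Complex.continuous_ofReal.comp (hf.continuous_deriv le_rfl)).mul hg

/-- Riemann–Stieltjes sums converge to the Wiener integral. -/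
theorem tendsto_sum_wienerIntegral {f : ℝ → ℝ} (hf : ContDiff ℝ 1 f) {g : ℝ → ℂ}
    (hg : Continuous g) {r t : ℝ} (hrt : r ≤ t) :
    Filter.Tendsto (fun n : ℕ => ∑ i ∈ Finset.range (n + 1), (f (gridPoint r t n i) : ℂ) *
      (g (gridPoint r t n (i + 1)) - g (gridPoint r t n i))) Filter.atTop
      (nhds (wienerIntegral f g r t)) := by
  have hd : Continuous (deriv f) := hf.continuous_deriv le_rfl
  have hfg := continuous_deriv_ofReal_mul hf hg
  obtain ⟨M, hM⟩ := isCompact_Icc.exists_bound_of_continuousOn (s := Set.Icc r t) hd.continuousOn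
  have hM0 : 0 ≤ M := (norm_nonneg _).trans (hM r ⟨le_rfl, hrt⟩)
  have huc := (isCompact_Icc (a := r) (b := t)).uniformContinuousOn_of_continuous hg.continuousOn
  rw [Metric.uniformContinuousOn_iff] at huc
  rw [Metric.tendsto_atTop]
  intro ε hε
  -- The cell errors add up to at most M(t - r) times this tolerance; the 1 in the denominator
  -- covers M(t - r) = 0 and makes the result strictly less than ε.
  obtain ⟨δ, hδ, hgδ⟩ := huc (ε / (M * (t - r) + 1)) (by
    have : 0 ≤ M * (t - r) := mul_nonneg hM0 (by linarith)
    positivity)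
  have hMt : 0 ≤ M * (t - r) := mul_nonneg hM0 (by linarith)
  obtain ⟨n₀, hn₀⟩ := exists_nat_gt ((t - r) / δ)
  refine ⟨n₀, fun n hn => ?_⟩
  have hmesh : (t - r) / (n + 1) < δ := by
    rw [div_lt_iff₀ (by positivity)]
    rw [div_lt_iff₀ hδ] at hn₀
    have : (n₀ : ℝ) ≤ n := by exact_mod_cast hn
    nlinarith
  set s := gridPoint r t n with hs
  have hmono := monotone_gridPoint hrt n
  have hsplit : ∫ x in r..t, ((deriv f x : ℝ) : ℂ) * g x =
      ∑ i ∈ Finset.range (n + 1), ∫ x in s i..s (i + 1), ((deriv f x : ℝ) : ℂ) * g x := by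
    rw [intervalIntegral.sum_integral_adjacent_intervals
      (fun _ _ => hfg.intervalIntegrable _ _), hs, gridPoint_zero, gridPoint_last]
  -- Written as an integral of f', the increment of f makes the cell error the integral of f' times
  -- an oscillation of g.
  have hpiece : ∀ i, ((f (s (i + 1)) : ℂ) - f (s i)) * g (s (i + 1)) =
      ∫ x in s i..s (i + 1), ((deriv f x : ℝ) : ℂ) * g (s (i + 1)) := by
    intro i
    rw [intervalIntegral.integral_mul_const, intervalIntegral.integral_ofReal,
      intervalIntegral.integral_deriv_eq_sub
        (fun x _ => (hf.differentiable one_ne_zero).differentiableAt)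
        (hd.intervalIntegrable _ _)]
    push_cast
    rfl
  have hbound : ∀ i ∈ Finset.range (n + 1),
      ‖(∫ x in s i..s (i + 1), ((deriv f x : ℝ) : ℂ) * g x) -
        ((f (s (i + 1)) : ℂ) - f (s i)) * g (s (i + 1))‖ ≤
      M * (ε / (M * (t - r) + 1)) * (s (i + 1) - s i) := by
    intro i hi
    have hi' : i < n + 1 := Finset.mem_range.1 hi
    have hle : s i ≤ s (i + 1) := hmono (Nat.le_succ i)
    rw [hpiece, ← intervalIntegral.integral_sub (hfg.intervalIntegrable _ _)
      ((continuous_deriv_ofReal_mul hf (continuous_const (y := g (s (i + 1))))).intervalIntegrable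
        _ _),
      ← abs_of_nonneg (sub_nonneg.2 hle)]
    refine intervalIntegral.norm_integral_le_of_norm_le_const fun x hx => ?_
    rw [Set.uIoc_of_le hle] at hx
    have hxm : x ∈ Set.Icc r t :=
      ⟨(gridPoint_mem hrt hi'.le).1.trans hx.1.le, hx.2.trans (gridPoint_mem hrt (by omega)).2⟩
    rw [← mul_sub, norm_mul, Complex.norm_real]
    refine mul_le_mul (hM x hxm) ?_ (norm_nonneg _) hM0
    rw [← dist_eq_norm]
    refine (hgδ x hxm (s (i + 1)) (gridPoint_mem hrt (by omega)) ?_).le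
    rw [Real.dist_eq, abs_sub_comm, abs_of_nonneg (by linarith [hx.2])]
    have := gridPoint_succ_sub r t n i
    simp only [hs] at hx ⊢
    linarith [hx.1]
  have hsum := Finset.sum_range_sub s (n + 1)
  have e0 : s 0 = r := gridPoint_zero r t n
  have e1 : s (n + 1) = t := gridPoint_last r t n
  rw [e0, e1] at hsum
  rw [sum_mul_sub_by_parts (fun i => (f (s i) : ℂ)) (fun i => g (s i)), wienerIntegral, hsplit,
    dist_eq_norm, e0, e1, sub_sub_sub_cancel_left, ← Finset.sum_sub_distrib]
  refine (norm_sum_le _ _).trans_lt ?_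
  refine (Finset.sum_le_sum hbound).trans_lt ?_
  rw [← Finset.mul_sum, hsum]
  rw [show M * (ε / (M * (t - r) + 1)) * (t - r) = ε * (M * (t - r)) / (M * (t - r) + 1) by ring,
    div_lt_iff₀ (by positivity)]
  nlinarith

theorem wienerIntegral_add_adjacent {f : ℝ → ℝ} (hf : ContDiff ℝ 1 f) {g : ℝ → ℂ}
    (hg : Continuous g) (a b c : ℝ) :
    wienerIntegral f g a b + wienerIntegral f g b c = wienerIntegral f g a c := by
  have hfg := continuous_deriv_ofReal_mul hf hg
  simp only [wienerIntegral]
  rw [← intervalIntegral.integral_add_adjacent_intervals (hfg.intervalIntegrable a b)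
    (hfg.intervalIntegrable b c)]
  ring

theorem sum_wienerIntegral {f : ℝ → ℝ} (hf : ContDiff ℝ 1 f) {g : ℝ → ℂ}
    (hg : Continuous g) (s : ℕ → ℝ) (n : ℕ) :
    ∑ i ∈ Finset.range n, wienerIntegral f g (s i) (s (i + 1)) =
      wienerIntegral f g (s 0) (s n) := by
  induction n with
  | zero => simp [wienerIntegral]
  | succ n ih => rw [Finset.sum_range_succ, ih, wienerIntegral_add_adjacent hf hg]

/-- On a short interval this isolates an increment of the path, whose mean is known for centred
noise, from a Wiener integral with small integrand. -/
theorem wienerIntegral_sub_const (f : ℝ → ℝ) (g : ℝ → ℂ) (a b : ℝ) :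
    wienerIntegral f g a b =
      (f a : ℂ) * (g b - g a) + wienerIntegral (fun s => f s - f a) g a b := by
  simp only [wienerIntegral, deriv_sub_const]
  push_cast
  ring

/-! ### Centred noise processes: second moment and mean of their Wiener integrals -/

section Noise

variable {Ω : Type*} [MeasurableSpace Ω]

/-- A centred complex process starting at `0` with continuous paths, whose weighted sums of
increments are bounded in `L²` as for a Brownian motion of variance `A`. -/
structure IsCentredNoise (X : ℝ → Ω → ℂ) (A : ℝ) (P : Measure Ω) : Prop where
  aestronglyMeasurable : ∀ t, AEStronglyMeasurable (X t) P
  continuous : ∀ᵐ ω ∂P, Continuous fun t => X t ω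
  zero : ∀ᵐ ω ∂P, X 0 ω = 0
  integrable : ∀ t, Integrable (X t) P
  mean : ∀ t, ∫ ω, X t ω ∂P = 0
  sq_le : ∀ (n : ℕ) (c s : ℕ → ℝ), 0 ≤ s 0 → Monotone s →
    ∫⁻ ω, ‖∑ i ∈ Finset.range n, (c i : ℂ) * (X (s (i + 1)) ω - X (s i) ω)‖ₑ ^ 2 ∂P ≤
      ENNReal.ofReal (A * ∑ i ∈ Finset.range n, c i ^ 2 * (s (i + 1) - s i))

namespace IsCentredNoise

variable {P : Measure Ω} {X : ℝ → Ω → ℂ} {A : ℝ} {f : ℝ → ℝ} {r t : ℝ}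

theorem aestronglyMeasurable_wienerIntegral (hX : IsCentredNoise X A P)
    (hf : ContDiff ℝ 1 f) (hrt : r ≤ t) :
    AEStronglyMeasurable (fun ω => wienerIntegral f (fun s => X s ω) r t) P := by
  refine aestronglyMeasurable_of_tendsto_ae Filter.atTop
    (f := fun (n : ℕ) ω => ∑ i ∈ Finset.range (n + 1), (f (gridPoint r t n i) : ℂ) *
      (X (gridPoint r t n (i + 1)) ω - X (gridPoint r t n i) ω)) (fun n => ?_) ?_
  · exact Finset.aestronglyMeasurable_fun_sum _ fun i _ =>
      ((hX.aestronglyMeasurable _).sub (hX.aestronglyMeasurable _)).const_mul _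
  · filter_upwards [hX.continuous] with ω hω using tendsto_sum_wienerIntegral hf hω hrt

/-- The upper bound in the Itô isometry. -/
theorem lintegral_wienerIntegral_le (hX : IsCentredNoise X A P) (hA : 0 ≤ A)
    (hf : ContDiff ℝ 1 f) (hr : 0 ≤ r) (hrt : r ≤ t) {M : ℝ}
    (hM : ∀ s ∈ Set.Icc r t, |f s| ≤ M) :
    ∫⁻ ω, ‖wienerIntegral f (fun s => X s ω) r t‖ₑ ^ 2 ∂P ≤
      ENNReal.ofReal (A * (M ^ 2 * (t - r))) := by
  set S : ℕ → Ω → ℂ := fun n ω => ∑ i ∈ Finset.range (n + 1), (f (gridPoint r t n i) : ℂ) *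
      (X (gridPoint r t n (i + 1)) ω - X (gridPoint r t n i) ω) with hS
  have hSm : ∀ n, AEStronglyMeasurable (S n) P := fun n =>
    Finset.aestronglyMeasurable_fun_sum _ fun i _ =>
      ((hX.aestronglyMeasurable _).sub (hX.aestronglyMeasurable _)).const_mul _
  have hb : ∀ n, ∫⁻ ω, ‖S n ω‖ₑ ^ 2 ∂P ≤ ENNReal.ofReal (A * (M ^ 2 * (t - r))) := by
    intro n
    refine (hX.sq_le (n + 1) (fun i => f (gridPoint r t n i)) (gridPoint r t n)
      (by rwa [gridPoint_zero]) (monotone_gridPoint hrt n)).trans ?_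
    refine ENNReal.ofReal_le_ofReal (mul_le_mul_of_nonneg_left ?_ hA)
    have hsum := Finset.sum_range_sub (gridPoint r t n) (n + 1)
    rw [gridPoint_zero, gridPoint_last] at hsum
    rw [← hsum, Finset.mul_sum]
    refine Finset.sum_le_sum fun i hi => ?_
    refine mul_le_mul_of_nonneg_right ?_
      (sub_nonneg.2 (monotone_gridPoint hrt n (Nat.le_succ i)))
    rw [← sq_abs]
    exact pow_le_pow_left₀ (abs_nonneg _)
      (hM _ (gridPoint_mem hrt (Finset.mem_range.1 hi).le)) 2
  -- Fatou's lemma along the Riemann–Stieltjes sums, whose second moments are bounded uniformly in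
  -- n.
  calc ∫⁻ ω, ‖wienerIntegral f (fun s => X s ω) r t‖ₑ ^ 2 ∂P
      = ∫⁻ ω, Filter.liminf (fun n => ‖S n ω‖ₑ ^ 2) Filter.atTop ∂P := by
        refine lintegral_congr_ae ?_
        filter_upwards [hX.continuous] with ω hω
        refine (Filter.Tendsto.liminf_eq ?_).symm
        exact ((ENNReal.continuous_pow 2).tendsto _).comp
          ((tendsto_sum_wienerIntegral hf hω hrt).enorm)
    _ ≤ Filter.liminf (fun n => ∫⁻ ω, ‖S n ω‖ₑ ^ 2 ∂P) Filter.atTop :=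
        lintegral_liminf_le' fun n => (hSm n).enorm.pow_const 2
    _ ≤ ENNReal.ofReal (A * (M ^ 2 * (t - r))) :=
        Filter.liminf_le_of_le (by isBoundedDefault) fun b hb' =>
          let ⟨n, hn⟩ := hb'.exists; hn.trans (hb n)

theorem memLp_wienerIntegral (hX : IsCentredNoise X A P) (hA : 0 ≤ A)
    (hf : ContDiff ℝ 1 f) (hr : 0 ≤ r) (hrt : r ≤ t) :
    MemLp (fun ω => wienerIntegral f (fun s => X s ω) r t) 2 P := by
  obtain ⟨M, hM⟩ := isCompact_Icc.exists_bound_of_continuousOn (s := Set.Icc r t)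
    hf.continuous.continuousOn
  exact memLp_two_of_lintegral_le (hX.aestronglyMeasurable_wienerIntegral hf hrt)
    (hX.lintegral_wienerIntegral_le hA hf hr hrt hM)

/-- No limit is exchanged with the expectation. On a cell of length h the mean is that of a Wiener
integral with integrand at most L h, so its square is at most A L² h³; summing over n + 1 equal
cells leaves a bound of order 1/(n + 1). -/
theorem integral_wienerIntegral [IsProbabilityMeasure P] (hX : IsCentredNoise X A P) (hA : 0 ≤ A)
    (hf : ContDiff ℝ 1 f) (hr : 0 ≤ r) (hrt : r ≤ t) :
    ∫ ω, wienerIntegral f (fun s => X s ω) r t ∂P = 0 := by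
  obtain ⟨L, hL⟩ := isCompact_Icc.exists_bound_of_continuousOn (s := Set.Icc r t)
    (hf.continuous_deriv le_rfl).continuousOn
  have hstep : ∀ a b, r ≤ a → a ≤ b → b ≤ t →
      ‖∫ ω, wienerIntegral f (fun s => X s ω) a b ∂P‖ ^ 2 ≤ A * ((L * (b - a)) ^ 2 * (b - a)) := by
    intro a b hra hab hbt
    have hf' : ContDiff ℝ 1 fun s => f s - f a := hf.sub contDiff_const
    have hM : ∀ s ∈ Set.Icc a b, |f s - f a| ≤ L * (b - a) := by
      intro s hs
      have h := (convex_Icc r t).norm_image_sub_le_of_norm_deriv_le (f := f) (C := L)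
        (x := a) (y := s)
        (fun x _ => (hf.differentiable one_ne_zero).differentiableAt) hL
        ⟨hra, hab.trans hbt⟩ ⟨hra.trans hs.1, hs.2.trans hbt⟩
      have hL0 : 0 ≤ L := (norm_nonneg _).trans (hL a ⟨hra, hab.trans hbt⟩)
      refine h.trans (mul_le_mul_of_nonneg_left ?_ hL0)
      rw [Real.norm_eq_abs, abs_of_nonneg (by linarith [hs.1])]
      linarith [hs.2]
    have hW := hX.memLp_wienerIntegral hA hf' (hr.trans hra) hab
    have e : ∫ ω, wienerIntegral f (fun s => X s ω) a b ∂P =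
        ∫ ω, wienerIntegral (fun s => f s - f a) (fun s => X s ω) a b ∂P := by
      have hinc : Integrable (fun ω => (f a : ℂ) * (X b ω - X a ω)) P :=
        ((hX.integrable b).sub (hX.integrable a)).const_mul _
      simp_rw [fun ω => wienerIntegral_sub_const f (fun s => X s ω) a b]
      rw [integral_add hinc
        (hW.integrable (by norm_num)), integral_const_mul,
        integral_sub (hX.integrable b) (hX.integrable a), hX.mean, hX.mean]
      simp
    rw [e]
    have hba : 0 ≤ b - a := sub_nonneg.2 hab
    exact norm_integral_sq_le (by positivity) hW.1
      (hX.lintegral_wienerIntegral_le hA hf' (hr.trans hra) hab hM)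
  have hL0 : 0 ≤ L := (norm_nonneg _).trans (hL r ⟨le_rfl, hrt⟩)
  have htr : 0 ≤ t - r := sub_nonneg.2 hrt
  have hall : ∀ n : ℕ, ‖∫ ω, wienerIntegral f (fun s => X s ω) r t ∂P‖ ^ 2 ≤
      A * (L ^ 2 * (t - r) ^ 3) * (1 / ((n : ℝ) + 1)) := by
    intro n
    have e : ∫ ω, wienerIntegral f (fun s => X s ω) r t ∂P = ∑ i ∈ Finset.range (n + 1),
        ∫ ω, wienerIntegral f (fun s => X s ω) (gridPoint r t n i) (gridPoint r t n (i + 1)) ∂P := by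
      rw [← integral_finsetSum _ fun i hi => (hX.memLp_wienerIntegral hA hf
        (hr.trans (gridPoint_mem hrt (Finset.mem_range.1 hi).le).1)
        (monotone_gridPoint hrt n (Nat.le_succ i))).integrable (by norm_num)]
      refine integral_congr_ae ?_
      filter_upwards [hX.continuous] with ω hω
      rw [sum_wienerIntegral hf hω, gridPoint_zero, gridPoint_last]
    have hn : (0 : ℝ) < n + 1 := by positivity
    rw [e]
    have h1 := norm_sum_le (Finset.range (n + 1)) fun i =>
      ∫ ω, wienerIntegral f (fun s => X s ω) (gridPoint r t n i) (gridPoint r t n (i + 1)) ∂P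
    refine (pow_le_pow_left₀ (norm_nonneg _) h1 2).trans ?_
    -- Cauchy–Schwarz costs a factor n + 1 and the sum has n + 1 terms, against (n + 1)⁻³ from the
    -- cube of the cell length.
    refine sq_sum_le_card_mul_sum_sq.trans ?_
    have h2 : ∀ i ∈ Finset.range (n + 1), ‖∫ ω, wienerIntegral f (fun s => X s ω)
        (gridPoint r t n i) (gridPoint r t n (i + 1)) ∂P‖ ^ 2 ≤
        A * (L ^ 2 * ((t - r) / (n + 1)) ^ 3) := by
      intro i hi
      have hi' : i < n + 1 := Finset.mem_range.1 hi
      refine (hstep _ _ (gridPoint_mem hrt hi'.le).1 (monotone_gridPoint hrt n (Nat.le_succ i))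
        (gridPoint_mem hrt (by omega)).2).trans ?_
      rw [gridPoint_succ_sub]
      exact le_of_eq (by ring)
    refine (mul_le_mul_of_nonneg_left (Finset.sum_le_sum h2) (by positivity)).trans ?_
    rw [Finset.sum_const, Finset.card_range, nsmul_eq_mul]
    refine le_of_eq ?_
    push_cast
    field_simp
  have hlim := (tendsto_one_div_add_atTop_nhds_zero_nat (𝕜 := ℝ)).const_mul
    (A * (L ^ 2 * (t - r) ^ 3))
  have := ge_of_tendsto' hlim hall
  rw [mul_zero] at this
  have h2 := le_antisymm this (by positivity)
  simpa using h2

/-- The factor 2 is that of ‖x + y‖² ≤ 2‖x‖² + 2‖y‖²; it affects only the final constant. -/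
theorem add {Y : ℝ → Ω → ℂ} {B : ℝ} (hX : IsCentredNoise X A P) (hY : IsCentredNoise Y B P)
    (hA : 0 ≤ A) (hB : 0 ≤ B) :
    IsCentredNoise (fun t ω => X t ω + Y t ω) (2 * (A + B)) P where
  aestronglyMeasurable t := (hX.aestronglyMeasurable t).add (hY.aestronglyMeasurable t)
  continuous := by
    filter_upwards [hX.continuous, hY.continuous] with ω h1 h2 using h1.add h2
  zero := by
    filter_upwards [hX.zero, hY.zero] with ω h1 h2
    rw [h1, h2, add_zero]
  integrable t := (hX.integrable t).add (hY.integrable t)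
  mean t := by
    rw [integral_add (hX.integrable t) (hY.integrable t), hX.mean, hY.mean, add_zero]
  sq_le n c s hs0 hs := by
    have h0 : 0 ≤ ∑ i ∈ Finset.range n, c i ^ 2 * (s (i + 1) - s i) :=
      Finset.sum_nonneg fun i _ => mul_nonneg (sq_nonneg _) (sub_nonneg.2 (hs (Nat.le_succ i)))
    have h := lintegral_enorm_sq_add_le (mul_nonneg hA h0) (mul_nonneg hB h0)
      (Finset.aestronglyMeasurable_fun_sum (Finset.range n) fun i _ =>
        ((hX.aestronglyMeasurable (s (i + 1))).sub
          (hX.aestronglyMeasurable (s i))).const_mul (c i : ℂ))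
      (hX.sq_le n c s hs0 hs) (hY.sq_le n c s hs0 hs)
    rw [← add_mul, ← mul_assoc] at h
    refine le_trans (le_of_eq ?_) h
    congr 1
    ext ω
    congr 2
    simp only [Pi.sub_apply]
    rw [← Finset.sum_add_distrib]
    refine Finset.sum_congr rfl fun i _ => ?_
    ring

theorem mono {B : ℝ} (hX : IsCentredNoise X A P) (hAB : A ≤ B) : IsCentredNoise X B P where
  aestronglyMeasurable := hX.aestronglyMeasurable
  continuous := hX.continuous
  zero := hX.zero
  integrable := hX.integrable
  mean := hX.mean
  sq_le n c s hs0 hs := (hX.sq_le n c s hs0 hs).trans <| ENNReal.ofReal_le_ofReal <|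
    mul_le_mul_of_nonneg_right hAB <| Finset.sum_nonneg fun i _ =>
      mul_nonneg (sq_nonneg _) (sub_nonneg.2 (hs (Nat.le_succ i)))

end IsCentredNoise

end Noise

/-! ### The coefficients of the noise -/

section Noise

variable {Ω : Type*} [MeasurableSpace Ω] {P : Measure Ω}

theorem memLp_two_brownian [IsProbabilityMeasure P] {B : ℝ≥0 → Ω → ℝ} (hB : IsPreBrownianReal B P)
    (t : ℝ≥0) : MemLp (B t) 2 P :=
  (hB.isGaussianProcess.hasGaussianLaw_eval t).memLp_two

/-- The covariance of a Brownian motion at two times is their minimum; monotonicity of `s` decides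
every minimum, and the four terms cancel off the diagonal. -/
theorem covariance_increments [IsProbabilityMeasure P] {B : ℝ≥0 → Ω → ℝ}
    (hB : IsPreBrownianReal B P) {s : ℕ → ℝ≥0} (hs : Monotone s) (i j : ℕ) :
    cov[B (s (i + 1)) - B (s i), B (s (j + 1)) - B (s j); P] =
      if i = j then (s (i + 1) : ℝ) - s i else 0 := by
  have hm := fun i => memLp_two_brownian hB (s i)
  rw [covariance_sub_left (hm _) (hm _) ((hm _).sub (hm _)),
    covariance_sub_right (hm _) (hm _) (hm _), covariance_sub_right (hm _) (hm _) (hm _)]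
  simp only [hB.covariance_eval]
  rcases lt_trichotomy i j with h | h | h
  · rw [if_neg h.ne, min_eq_left (hs (by omega)), min_eq_left (hs (by omega)),
      min_eq_left (hs (by omega)), min_eq_left (hs (by omega))]
    ring
  · subst h
    rw [if_pos rfl, min_self, min_self, min_eq_right (hs (by omega)), min_eq_left (hs (by omega))]
    ring
  · rw [if_neg h.ne', min_eq_right (hs (by omega)), min_eq_right (hs (by omega)),
      min_eq_right (hs (by omega)), min_eq_right (hs (by omega))]
    ring

/-- The Itô isometry for step functions. -/
theorem integral_sq_sum_increments [IsProbabilityMeasure P] {B : ℝ≥0 → Ω → ℝ}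
    (hB : IsPreBrownianReal B P) {s : ℕ → ℝ≥0} (hs : Monotone s) (c : ℕ → ℝ) (n : ℕ) :
    ∫ ω, (∑ i ∈ Finset.range n, c i * (B (s (i + 1)) ω - B (s i) ω)) ^ 2 ∂P =
      ∑ i ∈ Finset.range n, c i ^ 2 * ((s (i + 1) : ℝ) - s i) := by
  have hm := fun i => memLp_two_brownian hB (s i)
  set Y : ℕ → Ω → ℝ := fun i => c i • (B (s (i + 1)) - B (s i)) with hY
  have hYm : ∀ i, MemLp (Y i) 2 P := fun i => ((hm (i + 1)).sub (hm i)).const_smul (c i)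
  have h0 : ∫ ω, (∑ i ∈ Finset.range n, Y i) ω ∂P = 0 := by
    simp only [Finset.sum_apply]
    rw [integral_finsetSum _ fun i _ => (hYm i).integrable (by norm_num)]
    refine Finset.sum_eq_zero fun i _ => ?_
    simp only [hY, Pi.smul_apply, Pi.sub_apply, smul_eq_mul]
    rw [integral_const_mul, integral_sub (hB.integrable_eval _) (hB.integrable_eval _),
      hB.integral_eval, hB.integral_eval]
    simp
  -- The sum is centred, so its second moment is its variance, a double sum of covariances of
  -- increments in which only the diagonal remains.
  have hvar := variance_sum' (μ := P) (s := Finset.range n) (X := Y) fun i _ => hYm i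
  rw [variance_of_integral_eq_zero (memLp_finsetSum' _ fun i _ => hYm i).aemeasurable h0] at hvar
  have e : ∀ ω, (∑ i ∈ Finset.range n, Y i) ω =
      ∑ i ∈ Finset.range n, c i * (B (s (i + 1)) ω - B (s i) ω) := by
    intro ω
    simp [hY]
  simp only [e] at hvar
  rw [hvar]
  refine Finset.sum_congr rfl fun i hi => ?_
  rw [Finset.sum_eq_single_of_mem i hi]
  · rw [hY, covariance_smul_left, covariance_smul_right, covariance_increments hB hs, if_pos rfl]
    ring
  · intro j _ hj
    rw [hY, covariance_smul_left, covariance_smul_right, covariance_increments hB hs,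
      if_neg hj.symm]
    ring

/-- The complex factor `z` accommodates the real, imaginary and sign-changed parts of the noise
coefficients. -/
theorem isCentredNoise_brownian [IsProbabilityMeasure P] {B : ℝ≥0 → Ω → ℝ}
    (hB : IsPreBrownianReal B P) (hc : ∀ᵐ ω ∂P, Continuous fun t => B t ω) (z : ℂ) :
    IsCentredNoise (fun t ω => z * (B t.toNNReal ω : ℂ)) (‖z‖ ^ 2) P where
  aestronglyMeasurable t := ((Complex.continuous_ofReal.comp_aestronglyMeasurable
    (hB.aemeasurable _).aestronglyMeasurable).const_mul z)
  continuous := by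
    filter_upwards [hc] with ω hω
    exact continuous_const.mul
      (Complex.continuous_ofReal.comp (hω.comp continuous_real_toNNReal))
  zero := by
    filter_upwards [hB.eval_zero_ae_eq_zero] with ω hω
    simp [hω]
  integrable t := (hB.integrable_eval _).ofReal.const_mul z
  mean t := by
    rw [integral_const_mul, integral_complex_ofReal, hB.integral_eval]
    simp
  sq_le n c s hs0 hs := by
    have hs' : Monotone fun i => (s i).toNNReal := fun i j hij => Real.toNNReal_mono (hs hij)
    -- Negative times are truncated to 0 by `toNNReal`; the requirement `0 ≤ s 0` in
    -- `IsCentredNoise.sq_le` excludes them.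
    have hcoe : ∀ i, ((s i).toNNReal : ℝ) = s i := fun i =>
      Real.coe_toNNReal _ (hs0.trans (hs (Nat.zero_le i)))
    have h := integral_sq_sum_increments hB hs' c n
    simp only [hcoe] at h
    have hm := fun i => memLp_two_brownian hB ((s i).toNNReal)
    have hmem : MemLp (fun ω => ∑ i ∈ Finset.range n,
        c i * (B (s (i + 1)).toNNReal ω - B (s i).toNNReal ω)) 2 P :=
      memLp_finsetSum _ fun i _ => ((hm (i + 1)).sub (hm i)).const_mul (c i)
    have hint := hmem.integrable_sq
    rw [← h, ← integral_const_mul, ofReal_integral_eq_lintegral_ofReal (hint.const_mul _)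
      (Filter.Eventually.of_forall fun ω => by positivity)]
    refine le_of_eq (lintegral_congr fun ω => ?_)
    rw [enorm_sq_eq_ofReal]
    congr 1
    have e : ∑ i ∈ Finset.range n, (c i : ℂ) * (z * (B (s (i + 1)).toNNReal ω : ℂ) -
        z * (B (s i).toNNReal ω : ℂ)) = z * ((∑ i ∈ Finset.range n,
          c i * (B (s (i + 1)).toNNReal ω - B (s i).toNNReal ω) : ℝ) : ℂ) := by
      push_cast
      rw [Finset.mul_sum]
      exact Finset.sum_congr rfl fun i _ => by ring
    rw [e, norm_mul, Complex.norm_real, mul_pow, Real.norm_eq_abs, sq_abs]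

/-- For m ≠ 0 the coefficient has two Brownian parts of variance A_ℓ/2 each, and
`IsCentredNoise.add` doubles their sum; for m = 0 the variance A_ℓ is enlarged to the same bound. -/
theorem isCentredNoise_noiseCoeff [IsProbabilityMeasure P] {A : ℕ → ℝ} (hA : ∀ l, 0 ≤ A l)
    {b : Fin 2 → ℕ → ℕ → ℝ≥0 → Ω → ℝ} (hb : IsBrownianFamily b P) {l : ℕ} {m : ℤ}
    (hm : m ∈ orders l) : IsCentredNoise (noiseCoeff A b l m) (2 * A l) P := by
  rw [Finset.mem_Icc] at hm
  have hml : m.natAbs ≤ l := by omega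
  have h0 := isCentredNoise_brownian (hb.brownian 0 l m.natAbs hml (by simp))
    (hb.continuous 0 l m.natAbs hml (by simp))
  by_cases hm0 : m = 0
  · subst hm0
    have h := h0 (Real.sqrt (A l) : ℂ)
    rw [Complex.norm_real, Real.norm_eq_abs, sq_abs, Real.sq_sqrt (hA l)] at h
    have e : noiseCoeff A b l 0 = fun t ω =>
        (Real.sqrt (A l) : ℂ) * (b 0 l (0 : ℤ).natAbs t.toNNReal ω : ℂ) := by
      ext t ω
      simp [noiseCoeff]
    rw [e]
    exact h.mono (by linarith [hA l])
  · have h1 := isCentredNoise_brownian (hb.brownian 1 l m.natAbs hml (fun _ => by omega))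
      (hb.continuous 1 l m.natAbs hml (fun _ => by omega))
    have hn : ‖(Real.sqrt (A l / 2) : ℂ)‖ ^ 2 = A l / 2 := by
      rw [Complex.norm_real, Real.norm_eq_abs, sq_abs, Real.sq_sqrt (by linarith [hA l])]
    have key : ∀ z w : ℂ, ‖z‖ ^ 2 = A l / 2 → ‖w‖ ^ 2 = A l / 2 →
        IsCentredNoise (fun t ω => z * (b 0 l m.natAbs t.toNNReal ω : ℂ) +
          w * (b 1 l m.natAbs t.toNNReal ω : ℂ)) (2 * A l) P := by
      intro z w hz hw
      have h := (h0 z).add (h1 w) (by positivity) (by positivity)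
      rw [hz, hw] at h
      exact h.mono (by linarith)
    rcases lt_or_gt_of_ne hm0 with hneg | hpos
    · have e : noiseCoeff A b l m = fun t ω =>
          ((-1) ^ m.natAbs * (Real.sqrt (A l / 2) : ℂ)) * (b 0 l m.natAbs t.toNNReal ω : ℂ) +
          ((-1) ^ m.natAbs * (Real.sqrt (A l / 2) : ℂ) * Complex.I) *
            (b 1 l m.natAbs t.toNNReal ω : ℂ) := by
        ext t ω
        rw [noiseCoeff, if_neg hm0, if_neg (by omega)]
        ring
      rw [e]
      refine key _ _ ?_ ?_
      · rw [norm_mul, norm_pow, norm_neg, norm_one, one_pow, one_mul, hn]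
      · rw [norm_mul, norm_mul, norm_pow, norm_neg, norm_one, one_pow, one_mul, Complex.norm_I,
          mul_one, hn]
    · have e : noiseCoeff A b l m = fun t ω =>
          (Real.sqrt (A l / 2) : ℂ) * (b 0 l m.natAbs t.toNNReal ω : ℂ) +
          (-(Real.sqrt (A l / 2) : ℂ) * Complex.I) * (b 1 l m.natAbs t.toNNReal ω : ℂ) := by
        ext t ω
        rw [noiseCoeff, if_neg hm0, if_pos hpos]
        ring
      rw [e]
      refine key _ _ hn ?_
      rw [norm_mul, norm_neg, Complex.norm_I, mul_one, hn]

end Noise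

/-! ### Variation of constants for the coefficient equations -/

/-- R₁' = R₂ and R₂' = -ℓ(ℓ+1) R₁, with values 0 and 1 at 0. Variation of constants rests on these
relations alone, so degree 0 needs no separate treatment there. -/
theorem hasDerivAt_R1 (l : ℕ) (t : ℝ) : HasDerivAt (R1 l) (R2 l t) t := by
  by_cases hl : l = 0
  · subst hl
    have e : R1 0 = fun t => t := by ext t; simp [R1]
    have e2 : R2 0 t = 1 := by simp [R2]
    rw [e, e2]
    exact hasDerivAt_id t
  · have hpos : 0 < Real.sqrt ((l : ℝ) * (l + 1)) := by
      have : (0 : ℝ) < l := by exact_mod_cast Nat.pos_of_ne_zero hl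
      exact Real.sqrt_pos.2 (by positivity)
    have e : R1 l = fun t => Real.sin (t * Real.sqrt ((l : ℝ) * (l + 1))) /
        Real.sqrt ((l : ℝ) * (l + 1)) := by ext t; simp [R1, hl]
    rw [e]
    have h := ((hasDerivAt_mul_const (x := t) (Real.sqrt ((l : ℝ) * (l + 1)))).sin).div_const
      (Real.sqrt ((l : ℝ) * (l + 1)))
    rwa [mul_div_cancel_right₀ _ hpos.ne'] at h

theorem hasDerivAt_R2 (l : ℕ) (t : ℝ) :
    HasDerivAt (R2 l) (-((l : ℝ) * (l + 1)) * R1 l t) t := by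
  have h := (hasDerivAt_mul_const (x := t) (Real.sqrt ((l : ℝ) * (l + 1)))).cos
  by_cases hl : l = 0
  · subst hl
    have e : R2 0 = fun _ => 1 := by ext t; simp [R2]
    rw [e]
    simpa using hasDerivAt_const t (1 : ℝ)
  · have hnn : (0 : ℝ) ≤ (l : ℝ) * (l + 1) := by positivity
    have hpos : 0 < Real.sqrt ((l : ℝ) * (l + 1)) := by
      have : (0 : ℝ) < l := by exact_mod_cast Nat.pos_of_ne_zero hl
      exact Real.sqrt_pos.2 (by positivity)
    have e : -((l : ℝ) * (l + 1)) * R1 l t =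
        -Real.sin (t * Real.sqrt ((l : ℝ) * (l + 1))) * Real.sqrt ((l : ℝ) * (l + 1)) := by
      rw [R1, if_neg hl]
      have hs := Real.mul_self_sqrt hnn
      nth_rewrite 1 [← hs]
      field_simp
    rw [e]
    exact h

theorem contDiff_R1 (l : ℕ) : ContDiff ℝ 1 (R1 l) := by
  by_cases hl : l = 0
  · have e : R1 l = fun t => t := by ext t; simp [R1, hl]
    rw [e]
    fun_prop
  · have e : R1 l = fun t => Real.sin (t * Real.sqrt ((l : ℝ) * (l + 1))) /
        Real.sqrt ((l : ℝ) * (l + 1)) := by ext t; simp [R1, hl]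
    rw [e]
    fun_prop

theorem contDiff_R2 (l : ℕ) : ContDiff ℝ 1 (R2 l) := by
  unfold R2
  fun_prop

theorem R1_zero (l : ℕ) : R1 l 0 = 0 := by simp [R1]

theorem R2_zero (l : ℕ) : R2 l 0 = 1 := by simp [R2]

theorem hasDerivAt_R1_sub (l : ℕ) (t s : ℝ) :
    HasDerivAt (fun s => R1 l (t - s)) (-R2 l (t - s)) s := by
  exact HasDerivAt.comp_const_sub t s (hasDerivAt_R1 l (t - s))

theorem hasDerivAt_R2_sub (l : ℕ) (t s : ℝ) :
    HasDerivAt (fun s => R2 l (t - s)) ((l : ℝ) * (l + 1) * R1 l (t - s)) s := by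
  simpa using HasDerivAt.comp_const_sub t s (hasDerivAt_R2 l (t - s))

/-- A path pair solving the coefficient equations satisfies the variation of constants formula on
every subinterval. -/
theorem variation_of_constants {l : ℕ} {T : ℝ} {x₁ x₂ : ℂ} {u₁ u₂ a : ℝ → ℂ}
    (h₁ : ContinuousOn u₁ (Set.Icc 0 T)) (h₂ : ContinuousOn u₂ (Set.Icc 0 T)) (ha : Continuous a)
    (hp : ∀ t ∈ Set.Icc 0 T, u₁ t = x₁ + ∫ s in (0 : ℝ)..t, u₂ s)
    (hv : ∀ t ∈ Set.Icc 0 T,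
      u₂ t = x₂ - ((l : ℂ) * (l + 1)) * (∫ s in (0 : ℝ)..t, u₁ s) + a t)
    {r t : ℝ} (hr : 0 ≤ r) (hrt : r ≤ t) (htT : t ≤ T) :
    u₁ t = (R2 l (t - r) : ℂ) * u₁ r + (R1 l (t - r) : ℂ) * u₂ r
        + wienerIntegral (fun s => R1 l (t - s)) a r t ∧
    u₂ t = -((l : ℂ) * (l + 1)) * (R1 l (t - r) : ℂ) * u₁ r + (R2 l (t - r) : ℂ) * u₂ r
        + wienerIntegral (fun s => R2 l (t - s)) a r t := by
  have hT : (0 : ℝ) ≤ T := hr.trans (hrt.trans htT)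
  -- Continuous extensions to the whole line give two-sided derivatives of the primitives, also at
  -- the ends of [0, T].
  set g₁ : ℝ → ℂ := Set.IccExtend hT ((Set.Icc 0 T).domRestrict u₁) with hg₁
  set g₂ : ℝ → ℂ := Set.IccExtend hT ((Set.Icc 0 T).domRestrict u₂) with hg₂
  have hc₁ : Continuous g₁ := (continuousOn_iff_continuous_domRestrict.1 h₁).Icc_extend'
  have hc₂ : Continuous g₂ := (continuousOn_iff_continuous_domRestrict.1 h₂).Icc_extend'
  have e₁ : ∀ s ∈ Set.Icc 0 T, g₁ s = u₁ s := fun s hs => by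
    rw [hg₁, Set.IccExtend_of_mem hT _ hs]; rfl
  have e₂ : ∀ s ∈ Set.Icc 0 T, g₂ s = u₂ s := fun s hs => by
    rw [hg₂, Set.IccExtend_of_mem hT _ hs]; rfl
  have hi : ∀ (g u : ℝ → ℂ), (∀ s ∈ Set.Icc 0 T, g s = u s) → ∀ s ∈ Set.Icc 0 T,
      ∫ x in (0 : ℝ)..s, u x = ∫ x in (0 : ℝ)..s, g x := by
    intro g u hgu s hs
    refine intervalIntegral.integral_congr fun x hx => ?_
    rw [Set.uIcc_of_le hs.1] at hx
    exact (hgu x ⟨hx.1, hx.2.trans hs.2⟩).symm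
  set U : ℝ → ℂ := fun s => x₁ + ∫ x in (0 : ℝ)..s, g₂ x with hU
  -- On [0, T] this is u₂ - a. It is differentiable although the noise path a need not be, which
  -- keeps the argument within ordinary calculus.
  set w : ℝ → ℂ := fun s => x₂ - ((l : ℂ) * (l + 1)) * ∫ x in (0 : ℝ)..s, g₁ x with hw
  have hU' : ∀ s, HasDerivAt U (g₂ s) s := fun s =>
    (intervalIntegral.integral_hasDerivAt_right (hc₂.intervalIntegrable _ _)
      hc₂.stronglyMeasurable.stronglyMeasurableAtFilter hc₂.continuousAt).const_add x₁
  have hw' : ∀ s, HasDerivAt w (-(((l : ℂ) * (l + 1)) * g₁ s)) s := fun s =>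
    ((intervalIntegral.integral_hasDerivAt_right (hc₁.intervalIntegrable _ _)
      hc₁.stronglyMeasurable.stronglyMeasurableAtFilter hc₁.continuousAt).const_mul _).const_sub x₂
  have eU : ∀ s ∈ Set.Icc 0 T, U s = u₁ s := fun s hs => by
    rw [hU, hp s hs, hi g₂ u₂ e₂ s hs]
  have ew : ∀ s ∈ Set.Icc 0 T, w s = u₂ s - a s := fun s hs => by
    rw [hw, hv s hs, hi g₁ u₁ e₁ s hs]; ring
  have hR1 : ∀ s, HasDerivAt (fun s => (R1 l (t - s) : ℂ)) (-(R2 l (t - s) : ℂ)) s := fun s => by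
    simpa using (hasDerivAt_R1_sub l t s).ofReal_comp
  have hR2 : ∀ s, HasDerivAt (fun s => (R2 l (t - s) : ℂ))
      ((l : ℂ) * (l + 1) * (R1 l (t - s) : ℂ)) s := fun s => by
    simpa using (hasDerivAt_R2_sub l t s).ofReal_comp
  have hcR1 : Continuous fun s => (R1 l (t - s) : ℂ) :=
    continuous_iff_continuousAt.2 fun s => (hR1 s).continuousAt
  have hcR2 : Continuous fun s => (R2 l (t - s) : ℂ) :=
    continuous_iff_continuousAt.2 fun s => (hR2 s).continuousAt
  have hmem : ∀ s ∈ Set.uIcc r t, s ∈ Set.Icc 0 T := fun s hs => by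
    rw [Set.uIcc_of_le hrt] at hs
    exact ⟨hr.trans hs.1, hs.2.trans htT⟩
  have hrm : r ∈ Set.Icc 0 T := ⟨hr, hrt.trans htT⟩
  have htm : t ∈ Set.Icc 0 T := ⟨hr.trans hrt, htT⟩
  -- The derivative of R₂(t-s) u₁ + R₁(t-s) (u₂ - a) in s is R₂(t-s) a: the homogeneous terms
  -- cancel.
  have I₁ : ∫ s in r..t, (R2 l (t - s) : ℂ) * a s =
      ((R2 l (t - t) : ℂ) * U t + (R1 l (t - t) : ℂ) * w t) -
        ((R2 l (t - r) : ℂ) * U r + (R1 l (t - r) : ℂ) * w r) := by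
    refine intervalIntegral.integral_eq_sub_of_hasDerivAt
      (f := fun s => (R2 l (t - s) : ℂ) * U s + (R1 l (t - s) : ℂ) * w s) (fun s hs => ?_)
      ((hcR2.mul ha).intervalIntegrable _ _)
    refine (((hR2 s).mul (hU' s)).add ((hR1 s).mul (hw' s))).congr_deriv ?_
    have hs' := hmem s hs
    rw [eU s hs', e₂ s hs', ew s hs', e₁ s hs']
    ring
  -- The same for the second row, where the derivative is -ℓ(ℓ+1) R₁(t-s) a; hence the outer minus
  -- sign.
  have I₂ : ∫ s in r..t, ((l : ℂ) * (l + 1) * (R1 l (t - s) : ℂ)) * a s =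
      -((-((l : ℂ) * (l + 1)) * (R1 l (t - t) : ℂ) * U t + (R2 l (t - t) : ℂ) * w t) -
        (-((l : ℂ) * (l + 1)) * (R1 l (t - r) : ℂ) * U r + (R2 l (t - r) : ℂ) * w r)) := by
    rw [← neg_eq_iff_eq_neg, ← intervalIntegral.integral_neg]
    refine intervalIntegral.integral_eq_sub_of_hasDerivAt
      (f := fun s => -((l : ℂ) * (l + 1)) * (R1 l (t - s) : ℂ) * U s + (R2 l (t - s) : ℂ) * w s)
      (fun s hs => ?_)
      ((((continuous_const.mul hcR1).mul ha).neg).intervalIntegrable _ _)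
    refine (((((hR1 s).const_mul (-((l : ℂ) * (l + 1)))).mul (hU' s)).add
      ((hR2 s).mul (hw' s)))).congr_deriv ?_
    have hs' := hmem s hs
    rw [eU s hs', e₂ s hs', ew s hs', e₁ s hs']
    ring
  have d₁ : ∀ s, deriv (fun s => R1 l (t - s)) s = -R2 l (t - s) := fun s =>
    (hasDerivAt_R1_sub l t s).deriv
  have d₂ : ∀ s, deriv (fun s => R2 l (t - s)) s = (l : ℝ) * (l + 1) * R1 l (t - s) := fun s =>
    (hasDerivAt_R2_sub l t s).deriv
  rw [eU t htm, eU r hrm, ew t htm, ew r hrm, sub_self, R1_zero, R2_zero] at I₁ I₂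
  -- By the values of R₁ and R₂ at 0, the boundary term at t vanishes here and equals a(t) in `W₂`;
  -- the latter restores u₂ from u₂ - a.
  have W₁ : wienerIntegral (fun s => R1 l (t - s)) a r t =
      -(R1 l (t - r) : ℂ) * a r + ∫ s in r..t, (R2 l (t - s) : ℂ) * a s := by
    simp only [wienerIntegral, d₁, sub_self, R1_zero]
    push_cast
    simp only [neg_mul, intervalIntegral.integral_neg]
    ring
  have W₂ : wienerIntegral (fun s => R2 l (t - s)) a r t = a t - (R2 l (t - r) : ℂ) * a r -
      ∫ s in r..t, ((l : ℂ) * (l + 1) * (R1 l (t - s) : ℂ)) * a s := by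
    simp only [wienerIntegral, d₂, sub_self, R2_zero]
    push_cast
    ring
  constructor
  · rw [W₁, I₁]
    push_cast
    ring
  · rw [W₂, I₂]
    push_cast
    ring

/-- On the grid, the recursion reproduces the exact solution. -/
theorem recursion_eq_solution {l : ℕ} {T : ℝ} {x₁ x₂ : ℂ} {u₁ u₂ a : ℝ → ℂ}
    (h₁ : ContinuousOn u₁ (Set.Icc 0 T)) (h₂ : ContinuousOn u₂ (Set.Icc 0 T)) (ha : Continuous a)
    (ha0 : a 0 = 0) (hp : ∀ t ∈ Set.Icc 0 T, u₁ t = x₁ + ∫ s in (0 : ℝ)..t, u₂ s)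
    (hv : ∀ t ∈ Set.Icc 0 T,
      u₂ t = x₂ - ((l : ℂ) * (l + 1)) * (∫ s in (0 : ℝ)..t, u₁ s) + a t)
    {τ : ℕ → ℝ} {n : ℕ} (hτ0 : τ 0 = 0) (hτ : ∀ j < n, τ j < τ (j + 1)) (hτn : τ n ≤ T) :
    recursion l x₁ x₂ a τ n = (u₁ (τ n), u₂ (τ n)) := by
  induction n with
  | zero =>
    rw [hτ0] at hτn ⊢
    have h0 : (0 : ℝ) ∈ Set.Icc 0 T := ⟨le_rfl, hτn⟩
    rw [hp 0 h0, hv 0 h0]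
    simp [recursion, ha0]
  | succ n ih =>
    have hlt := hτ n (Nat.lt_succ_self n)
    have hnn : ∀ j ≤ n, 0 ≤ τ j := by
      intro j hj
      induction j with
      | zero => exact hτ0.ge
      | succ j ihj => exact (ihj (by omega)).trans (hτ j (by omega)).le
    have ih' := ih (fun j hj => hτ j (by omega)) (hlt.le.trans hτn)
    obtain ⟨k₁, k₂⟩ := variation_of_constants h₁ h₂ ha hp hv (hnn n le_rfl) hlt.le hτn
    rw [recursion, ih', k₁, k₂]

/-! ### Decay of the tails -/

/-- Comparison of a decreasing power with its integral from κ, the first omitted degree being κ + 1.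
A bound uniform in the number of terms gives summability and the tail estimate together. -/
theorem sum_rpow_tail_le {e : ℝ} (he : 1 < e) {κ : ℕ} (hκ : 0 < κ) (n : ℕ) :
    ∑ l ∈ Finset.range n, ((l + (κ + 1) : ℕ) : ℝ) ^ (-e) ≤ (κ : ℝ) ^ (-(e - 1)) / (e - 1) := by
  have hκ' : (0 : ℝ) < κ := by exact_mod_cast hκ
  have hanti : AntitoneOn (fun x : ℝ => x ^ (-e)) (Set.Icc (κ : ℝ) (κ + n)) := by
    intro x hx y hy hxy
    exact Real.rpow_le_rpow_of_nonpos (hκ'.trans_le hx.1) hxy (by linarith)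
  have h := hanti.sum_le_integral
  have hpos : ∀ x ∈ Set.uIcc (κ : ℝ) (κ + n), x ≠ 0 := by
    intro x hx
    rw [Set.uIcc_of_le (by linarith [(Nat.cast_nonneg n : (0 : ℝ) ≤ n)])] at hx
    exact (hκ'.trans_le hx.1).ne'
  rw [integral_rpow (Or.inr ⟨by linarith, fun h0 => hpos 0 h0 rfl⟩)] at h
  calc ∑ l ∈ Finset.range n, ((l + (κ + 1) : ℕ) : ℝ) ^ (-e)
      = ∑ l ∈ Finset.range n, ((κ : ℝ) + ((l + 1 : ℕ) : ℝ)) ^ (-e) := by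
        refine Finset.sum_congr rfl fun l _ => ?_
        congr 1
        push_cast
        ring
    _ ≤ _ := h
    _ = ((κ : ℝ) ^ (-(e - 1)) - ((κ : ℝ) + n) ^ (-(e - 1))) / (e - 1) := by
        rw [show -e + 1 = -(e - 1) by ring, div_neg, ← neg_div, neg_sub]
    _ ≤ _ := by
        have h1 : 0 ≤ ((κ : ℝ) + n) ^ (-(e - 1)) := by positivity
        have h2 : 0 < e - 1 := by linarith
        gcongr
        linarith

theorem summable_rpow_tail {e : ℝ} (he : 1 < e) {κ : ℕ} (hκ : 0 < κ) :
    Summable fun l : ℕ => ((l + (κ + 1) : ℕ) : ℝ) ^ (-e) :=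
  summable_of_sum_range_le (fun _ => by positivity) (sum_rpow_tail_le he hκ)

theorem tsum_rpow_tail_le {e : ℝ} (he : 1 < e) {κ : ℕ} (hκ : 0 < κ) :
    ∑' l : ℕ, ((l + (κ + 1) : ℕ) : ℝ) ^ (-e) ≤ (κ : ℝ) ^ (-(e - 1)) / (e - 1) :=
  Real.tsum_le_of_sum_range_le (fun _ => by positivity) (sum_rpow_tail_le he hκ)

/-- The eigenvalue `1 + ℓ(ℓ+1)` of `Id - Δ`. -/
noncomputable def eigen (l : ℕ) : ℝ := 1 + (l : ℝ) * (l + 1)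

theorem one_le_eigen (l : ℕ) : 1 ≤ eigen l := by
  have : (0 : ℝ) ≤ (l : ℝ) * (l + 1) := by positivity
  simp only [eigen]
  linarith

theorem eigen_pos (l : ℕ) : 0 < eigen l := zero_lt_one.trans_le (one_le_eigen l)

theorem sq_le_eigen (l : ℕ) : (l : ℝ) ^ 2 ≤ eigen l := by
  have : (0 : ℝ) ≤ l := by positivity
  simp only [eigen]
  nlinarith

/-- Eigenvalues grow at least like ℓ², which is why eigenvalue exponents double when they become
powers of κ. -/
theorem eigen_rpow_le {k l : ℕ} (hk : 0 < k) (hkl : k ≤ l) {p : ℝ} (hp : p ≤ 0) :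
    eigen l ^ p ≤ (k : ℝ) ^ (2 * p) := by
  have hk' : (0 : ℝ) < k := by exact_mod_cast hk
  have hkl' : (k : ℝ) ≤ l := by exact_mod_cast hkl
  rw [Real.rpow_mul hk'.le, Real.rpow_two]
  exact Real.rpow_le_rpow_of_nonpos (by positivity)
    ((pow_le_pow_left₀ hk'.le hkl' 2).trans (sq_le_eigen l)) hp

/-- `∑_m |f^{ℓ,m}|²`. -/
noncomputable def power (f : L2) (l : ℕ) : ℝ := ∑ m ∈ orders l, ‖coeff f l m‖ ^ 2

theorem power_nonneg (f : L2) (l : ℕ) : 0 ≤ power f l :=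
  Finset.sum_nonneg fun _ _ => by positivity

theorem sobolevTerm_nonneg (s : ℝ) (f : L2) (l : ℕ) : 0 ≤ sobolevTerm s f l :=
  mul_nonneg (Real.rpow_nonneg (eigen_pos l).le s) (power_nonneg f l)

theorem sobolevNorm_nonneg (s : ℝ) (f : L2) : 0 ≤ sobolevNorm s f := Real.sqrt_nonneg _

theorem sobolevNorm_sq (s : ℝ) (f : L2) : sobolevNorm s f ^ 2 = ∑' l, sobolevTerm s f l :=
  Real.sq_sqrt (tsum_nonneg (sobolevTerm_nonneg s f))

theorem eigen_rpow_mul_power (p s : ℝ) (f : L2) (l : ℕ) :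
    eigen l ^ p * power f l = eigen l ^ (p - s) * sobolevTerm s f l := by
  have h : sobolevTerm s f l = eigen l ^ s * power f l := rfl
  rw [h, ← mul_assoc, ← Real.rpow_add (eigen_pos l), sub_add_cancel]

theorem summable_eigen_rpow_mul_power {p s : ℝ} (hps : p ≤ s) {f : L2} (hf : MemSobolev s f) :
    Summable fun l => eigen l ^ p * power f l := by
  refine Summable.of_nonneg_of_le
    (fun l => mul_nonneg (Real.rpow_nonneg (eigen_pos l).le p) (power_nonneg f l)) (fun l => ?_) hf
  rw [eigen_rpow_mul_power p s]
  exact mul_le_of_le_one_left (sobolevTerm_nonneg s f l)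
    (Real.rpow_le_one_of_one_le_of_nonpos (one_le_eigen l) (by linarith))

/-- Excess smoothness becomes decay: beyond degree κ the factor λ^(p-s) is at most κ^(-2(s-p)), and
what remains is part of the H^s norm. -/
theorem tsum_eigen_rpow_mul_power_le {p s : ℝ} (hps : p ≤ s) {f : L2} (hf : MemSobolev s f)
    {κ : ℕ} (hκ : 0 < κ) :
    ∑' l, eigen (l + (κ + 1)) ^ p * power f (l + (κ + 1)) ≤
      (κ : ℝ) ^ (-(2 * (s - p))) * sobolevNorm s f ^ 2 := by
  have hs : Summable (sobolevTerm s f) := hf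
  have hsum : Summable fun l => sobolevTerm s f (l + (κ + 1)) :=
    (summable_nat_add_iff (κ + 1)).2 hs
  have hsum' : Summable fun l => eigen (l + (κ + 1)) ^ p * power f (l + (κ + 1)) :=
    (summable_nat_add_iff (f := fun l => eigen l ^ p * power f l) (κ + 1)).2
      (summable_eigen_rpow_mul_power hps hf)
  have hle : ∀ l, eigen (l + (κ + 1)) ^ p * power f (l + (κ + 1)) ≤
      (κ : ℝ) ^ (-(2 * (s - p))) * sobolevTerm s f (l + (κ + 1)) := by
    intro l
    rw [eigen_rpow_mul_power p s]
    refine mul_le_mul_of_nonneg_right ?_ (sobolevTerm_nonneg s f _)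
    have h := eigen_rpow_le hκ (show κ ≤ l + (κ + 1) by omega) (show p - s ≤ 0 by linarith)
    rwa [show 2 * (p - s) = -(2 * (s - p)) by ring] at h
  calc ∑' l, eigen (l + (κ + 1)) ^ p * power f (l + (κ + 1))
      ≤ ∑' l, (κ : ℝ) ^ (-(2 * (s - p))) * sobolevTerm s f (l + (κ + 1)) :=
        hsum'.tsum_le_tsum hle (hsum.mul_left _)
    _ = (κ : ℝ) ^ (-(2 * (s - p))) * ∑' l, sobolevTerm s f (l + (κ + 1)) := tsum_mul_left
    _ ≤ (κ : ℝ) ^ (-(2 * (s - p))) * sobolevNorm s f ^ 2 := by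
        rw [sobolevNorm_sq]
        refine mul_le_mul_of_nonneg_left ?_ (by positivity)
        have h := hs.sum_add_tsum_nat_add (κ + 1)
        have h0 := Finset.sum_nonneg fun l (_ : l ∈ Finset.range (κ + 1)) =>
          sobolevTerm_nonneg s f l
        linarith

/-- The 2k + 1 ≤ 3k orders of degree k cost one power of k, the spectrum gains α, and the weight
gains -2p. -/
theorem noise_term_le {A : ℕ → ℝ} {l₀ : ℕ} {C α p : ℝ} (hC : 0 < C) (hp : p ≤ 0)
    (hdecay : ∀ l > l₀, A l ≤ C * (l : ℝ) ^ (-α)) {κ : ℕ} (hκ : l₀ < κ) (l : ℕ) :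
    (2 * ((l + (κ + 1) : ℕ) : ℝ) + 1) * (A (l + (κ + 1)) * eigen (l + (κ + 1)) ^ p) ≤
      3 * C * ((l + (κ + 1) : ℕ) : ℝ) ^ (-(α - 1 - 2 * p)) := by
  set k := l + (κ + 1) with hk
  have hk0 : 0 < k := by omega
  have hk' : (0 : ℝ) < k := by exact_mod_cast hk0
  have hk1 : (1 : ℝ) ≤ k := by exact_mod_cast hk0
  have h1 := eigen_rpow_le hk0 le_rfl hp
  have h2 := hdecay k (by omega)
  have h3 : A k * eigen k ^ p ≤ C * (k : ℝ) ^ (-α) * (k : ℝ) ^ (2 * p) :=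
    mul_le_mul h2 h1 (Real.rpow_nonneg (eigen_pos k).le p) (by positivity)
  calc (2 * (k : ℝ) + 1) * (A k * eigen k ^ p)
      ≤ (2 * (k : ℝ) + 1) * (C * (k : ℝ) ^ (-α) * (k : ℝ) ^ (2 * p)) := by gcongr
    _ ≤ (3 * k) * (C * (k : ℝ) ^ (-α) * (k : ℝ) ^ (2 * p)) := by
        gcongr
        linarith
    _ = 3 * C * ((k : ℝ) ^ (1 : ℝ) * (k : ℝ) ^ (-α) * (k : ℝ) ^ (2 * p)) := by
        rw [Real.rpow_one]; ring
    _ = _ := by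
        rw [← Real.rpow_add hk', ← Real.rpow_add hk']
        congr 2
        ring

theorem noise_tail {A : ℕ → ℝ} {l₀ : ℕ} {C α p : ℝ} (hC : 0 < C) (hα : 2 < α) (hp : p ≤ 0)
    (hA : ∀ l, 0 ≤ A l) (hdecay : ∀ l > l₀, A l ≤ C * (l : ℝ) ^ (-α)) {κ : ℕ} (hκ : l₀ < κ) :
    (Summable fun l : ℕ => (2 * (l : ℝ) + 1) * (A l * eigen l ^ p)) ∧
    ∑' l : ℕ, (2 * ((l + (κ + 1) : ℕ) : ℝ) + 1) * (A (l + (κ + 1)) * eigen (l + (κ + 1)) ^ p) ≤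
      3 * C / (α - 2) * (κ : ℝ) ^ (-(α - 2 - 2 * p)) := by
  have he : 1 < α - 1 - 2 * p := by linarith
  have hκ0 : 0 < κ := by omega
  -- The spectrum is controlled only beyond l₀ < κ, so summability is shown for the tail and then
  -- carried over to the full series.
  have hs : Summable fun l : ℕ => (2 * ((l + (κ + 1) : ℕ) : ℝ) + 1) *
      (A (l + (κ + 1)) * eigen (l + (κ + 1)) ^ p) :=
    Summable.of_nonneg_of_le (fun l => mul_nonneg (by positivity)
      (mul_nonneg (hA _) (Real.rpow_nonneg (eigen_pos _).le p)))
      (noise_term_le hC hp hdecay hκ) ((summable_rpow_tail he hκ0).mul_left (3 * C))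
  refine ⟨(summable_nat_add_iff (κ + 1)).1 hs, ?_⟩
  calc _ ≤ ∑' l : ℕ, 3 * C * ((l + (κ + 1) : ℕ) : ℝ) ^ (-(α - 1 - 2 * p)) :=
        Summable.tsum_le_tsum (noise_term_le hC hp hdecay hκ) hs
          ((summable_rpow_tail he hκ0).mul_left (3 * C))
    _ = 3 * C * ∑' l : ℕ, ((l + (κ + 1) : ℕ) : ℝ) ^ (-(α - 1 - 2 * p)) := tsum_mul_left
    _ ≤ 3 * C * ((κ : ℝ) ^ (-(α - 1 - 2 * p - 1)) / (α - 1 - 2 * p - 1)) := by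
        gcongr
        exact tsum_rpow_tail_le he hκ0
    _ = 3 * C * ((κ : ℝ) ^ (-(α - 2 - 2 * p)) / (α - 2 - 2 * p)) := by
        rw [show α - 1 - 2 * p - 1 = α - 2 - 2 * p by ring]
    -- Since p ≤ 0, the smaller denominator α - 2 is positive and gives a constant independent of p.
    _ ≤ 3 * C * ((κ : ℝ) ^ (-(α - 2 - 2 * p)) / (α - 2)) := by
        have : 0 < α - 2 := by linarith
        exact mul_le_mul_of_nonneg_left
          (div_le_div_of_nonneg_left (by positivity) this (by linarith)) (by positivity)
    _ = _ := by ring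

/-! ### Bounds for the propagators -/

theorem R2_sq_le (l : ℕ) (t : ℝ) : R2 l t ^ 2 ≤ 1 := Real.cos_sq_le_one _

/-- The term T² is needed for degree 0, where R₁(t) = t. For ℓ ≥ 1 the bound 1/(ℓ(ℓ+1)) ≤ 2/(1 +
ℓ(ℓ+1)) accounts for the 2. -/
theorem R1_sq_le {l : ℕ} {T t : ℝ} (ht : t ∈ Set.Icc 0 T) :
    R1 l t ^ 2 ≤ (2 + T ^ 2) * eigen l ^ (-1 : ℝ) := by
  rw [Real.rpow_neg_one, ← div_eq_mul_inv, le_div_iff₀ (eigen_pos l)]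
  by_cases hl : l = 0
  · subst hl
    simp only [R1, eigen, if_true]
    have := pow_le_pow_left₀ ht.1 ht.2 2
    push_cast
    nlinarith
  · have hl1 : (1 : ℝ) ≤ l := by exact_mod_cast Nat.pos_of_ne_zero hl
    have hpos : (1 : ℝ) ≤ (l : ℝ) * (l + 1) := by nlinarith
    rw [R1, if_neg hl, div_pow, Real.sq_sqrt (by linarith), eigen, div_mul_eq_mul_div,
      div_le_iff₀ (by linarith)]
    have := Real.sin_sq_le_one (t * Real.sqrt ((l : ℝ) * (l + 1)))
    nlinarith [sq_nonneg T]

theorem eigenvalue_mul_R1_sq_le (l : ℕ) (t : ℝ) :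
    ((l : ℝ) * (l + 1) * R1 l t) ^ 2 ≤ eigen l ^ (1 : ℝ) := by
  rw [Real.rpow_one]
  by_cases hl : l = 0
  · subst hl
    simp [eigen]
  · have hl1 : (1 : ℝ) ≤ l := by exact_mod_cast Nat.pos_of_ne_zero hl
    have hpos : (1 : ℝ) ≤ (l : ℝ) * (l + 1) := by nlinarith
    rw [R1, if_neg hl, mul_pow, div_pow, Real.sq_sqrt (by linarith), eigen]
    have := Real.sin_sq_le_one (t * Real.sqrt ((l : ℝ) * (l + 1)))
    rw [← mul_div_assoc, div_le_iff₀ (by linarith)]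
    nlinarith

/-! ### Truncation of random fields on the sphere -/

section Truncation

variable {Ω : Type*} [MeasurableSpace Ω] {P : Measure Ω} [IsProbabilityMeasure P]

/-- Transfers the abstract truncation result to coefficient data. The approximation enters only as
the partial sum of the exact series, and each degree collects the variance bounds of its 2ℓ + 1
orders. -/
theorem field_truncation {u : ℕ → ℤ → ℝ → Ω → ℂ} {t : ℝ} {d : ℕ → ℤ → ℂ} {w : ℕ → ℤ → Ω → ℂ}
    {q : ℕ → ℝ} {Uκ : Ω → L2} {k : ℕ}
    (hu : ∀ᵐ ω ∂P, ∀ l, ∀ m ∈ orders l, u l m t ω = d l m + w l m ω)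
    (hUκ : ∀ᵐ ω ∂P, Uκ ω = ∑ l ∈ Finset.range k, ∑ m ∈ orders l, u l m t ω • harmonic l m)
    (hw : ∀ l, ∀ m ∈ orders l, AEStronglyMeasurable (w l m) P)
    (hw0 : ∀ l, ∀ m ∈ orders l, ∫ ω, w l m ω ∂P = 0)
    (hwq : ∀ l, ∀ m ∈ orders l, ∫⁻ ω, ‖w l m ω‖ₑ ^ 2 ∂P ≤ ENNReal.ofReal (q l))
    (hq0 : ∀ l, 0 ≤ q l) (hd : Summable fun l => ∑ m ∈ orders l, ‖d l m‖ ^ 2)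
    (hq : Summable fun l : ℕ => (2 * (l : ℝ) + 1) * q l) :
    FieldConverges P u t ∧ MemLp (field u t) 2 P ∧ MemLp Uκ 2 P ∧
    ‖∫ ω, (field u t ω - Uκ ω) ∂P‖ ≤
      Real.sqrt (∑' l, ∑ m ∈ orders (l + k), ‖d (l + k) m‖ ^ 2) ∧
    |∫ ω, (‖field u t ω‖ ^ 2 - ‖Uκ ω‖ ^ 2) ∂P| ≤
      2 * (∑' l, ∑ m ∈ orders (l + k), ‖d (l + k) m‖ ^ 2 +
        ∑' l, (2 * ((l + k : ℕ) : ℝ) + 1) * q (l + k)) := by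
  set D : ℕ → L2 := fun l => ∑ m ∈ orders l, d l m • harmonic l m with hD
  set N : ℕ → Ω → L2 := fun l ω => ∑ m ∈ orders l, w l m ω • harmonic l m with hN
  have hnD : ∀ l, ‖D l‖ ^ 2 = ∑ m ∈ orders l, ‖d l m‖ ^ 2 := fun l =>
    norm_sq_sum_smul_harmonic l _
  have hNm : ∀ l, AEStronglyMeasurable (N l) P := fun l =>
    Finset.aestronglyMeasurable_fun_sum _ fun m hm =>
      (hw l m hm).smul aestronglyMeasurable_const
  have hNq : ∀ l, ∫⁻ ω, ‖N l ω‖ₑ ^ 2 ∂P ≤ ENNReal.ofReal ((2 * (l : ℝ) + 1) * q l) := by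
    intro l
    have e : ∀ ω, ‖N l ω‖ₑ ^ 2 = ∑ m ∈ orders l, ‖w l m ω‖ₑ ^ 2 := by
      intro ω
      rw [enorm_sq_eq_ofReal, hN, norm_sq_sum_smul_harmonic,
        ENNReal.ofReal_sum_of_nonneg fun _ _ => by positivity]
      simp_rw [enorm_sq_eq_ofReal]
    simp_rw [e]
    rw [lintegral_finsetSum' _ fun m hm => (hw l m hm).enorm.pow_const 2]
    refine (Finset.sum_le_sum fun m hm => hwq l m hm).trans (le_of_eq ?_)
    have hcard : ((orders l).card : ℝ) = 2 * l + 1 := by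
      rw [Int.card_Icc, show ((l : ℤ) + 1 - -(l : ℤ)).toNat = 2 * l + 1 by omega]
      push_cast
      ring
    rw [Finset.sum_const, ← hcard, ENNReal.ofReal_mul (by positivity), ENNReal.ofReal_natCast,
      nsmul_eq_mul]
  have hN0 : ∀ l, ∫ ω, N l ω ∂P = 0 := by
    intro l
    have hi : ∀ m ∈ orders l, Integrable (w l m) P := fun m hm =>
      (memLp_two_of_lintegral_le (hw l m hm) (hwq l m hm)).integrable (by norm_num)
    simp only [hN]
    rw [integral_finsetSum _ fun m hm => (hi m hm).smul_const (harmonic l m)]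
    refine Finset.sum_eq_zero fun m hm => ?_
    rw [integral_smul_const, hw0 l m hm, zero_smul]
  obtain ⟨c₁, c₂, c₃, c₄, c₅⟩ := orthogonal_series_truncation (P := P)
    orthogonalFamily_harmonicSpace
    (D := D) (N := N) (fun l => sum_smul_harmonic_mem l _) (by simpa only [hnD] using hd)
    (fun l ω => sum_smul_harmonic_mem l _) hNm
    (fun l => mul_nonneg (by positivity) (hq0 l)) hNq hq hN0 k
  simp only [hnD] at c₄ c₅
  have hterm : ∀ᵐ ω ∂P, ∀ l, ∑ m ∈ orders l, u l m t ω • harmonic l m = D l + N l ω := by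
    filter_upwards [hu] with ω hω l
    rw [hD, hN, ← Finset.sum_add_distrib]
    refine Finset.sum_congr rfl fun m hm => ?_
    rw [hω l m hm, add_smul]
  have hfield : ∀ᵐ ω ∂P, field u t ω = ∑' l, (D l + N l ω) := by
    filter_upwards [hterm] with ω hω
    simp only [field, hω]
  have happrox : ∀ᵐ ω ∂P, Uκ ω = ∑ l ∈ Finset.range k, (D l + N l ω) := by
    filter_upwards [hterm, hUκ] with ω hω h2
    rw [h2]
    exact Finset.sum_congr rfl fun l _ => hω l
  refine ⟨?_, ?_, ?_, ?_, ?_⟩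
  · filter_upwards [hterm, c₁] with ω hω h1
    simpa only [hω] using h1
  · refine c₂.ae_eq ?_
    filter_upwards [hfield] with ω hω using hω.symm
  · refine c₃.ae_eq ?_
    filter_upwards [happrox] with ω hω using hω.symm
  · rw [integral_congr_ae (g := fun ω => ∑' l, (D l + N l ω) -
      ∑ l ∈ Finset.range k, (D l + N l ω))]
    · exact c₄
    · filter_upwards [hfield, happrox] with ω h1 h2
      rw [h1, h2]
  · rw [integral_congr_ae (g := fun ω => ‖∑' l, (D l + N l ω)‖ ^ 2 -
      ‖∑ l ∈ Finset.range k, (D l + N l ω)‖ ^ 2)]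
    · exact c₅
    · filter_upwards [hfield, happrox] with ω h1 h2
      rw [h1, h2]

/-- Truncation error for a field whose mean and noise coefficients have the size
`(1 + ℓ(ℓ+1))^{(p+1)/2} |v₁| + (1 + ℓ(ℓ+1))^{p/2} |v₂|` and `A_ℓ (1 + ℓ(ℓ+1))^p`. -/
theorem truncation_bounds {u : ℕ → ℤ → ℝ → Ω → ℂ} {t : ℝ} {d : ℕ → ℤ → ℂ} {w : ℕ → ℤ → Ω → ℂ}
    {Uκ : Ω → L2} {κ l₀ : ℕ} {A : ℕ → ℝ} {C α p c β γ : ℝ} {v₁ v₂ : L2}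
    (hC : 0 < C) (hα : 2 < α) (hc : 1 ≤ c) (hp : p ≤ 0) (hA : ∀ l, 0 ≤ A l)
    (hdecay : ∀ l > l₀, A l ≤ C * (l : ℝ) ^ (-α)) (hκ : l₀ < κ)
    (hv₁ : MemSobolev β v₁) (hv₂ : MemSobolev γ v₂) (hβ : p + 1 ≤ β) (hγ : p ≤ γ)
    (hu : ∀ᵐ ω ∂P, ∀ l, ∀ m ∈ orders l, u l m t ω = d l m + w l m ω)
    (hUκ : ∀ᵐ ω ∂P,
      Uκ ω = ∑ l ∈ Finset.range (κ + 1), ∑ m ∈ orders l, u l m t ω • harmonic l m)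
    (hw : ∀ l, ∀ m ∈ orders l, AEStronglyMeasurable (w l m) P)
    (hw0 : ∀ l, ∀ m ∈ orders l, ∫ ω, w l m ω ∂P = 0)
    (hwq : ∀ l, ∀ m ∈ orders l,
      ∫⁻ ω, ‖w l m ω‖ₑ ^ 2 ∂P ≤ ENNReal.ofReal (c * (A l * eigen l ^ p)))
    (hd : ∀ l, ∑ m ∈ orders l, ‖d l m‖ ^ 2 ≤
      c * (eigen l ^ (p + 1) * power v₁ l + eigen l ^ p * power v₂ l)) :
    FieldConverges P u t ∧ MemLp (field u t) 2 P ∧ MemLp Uκ 2 P ∧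
    ‖∫ ω, (field u t ω - Uκ ω) ∂P‖ ≤ 2 * (c + c * (3 * C / (α - 2))) *
      ((κ : ℝ) ^ (-(β - (p + 1))) * sobolevNorm β v₁ + (κ : ℝ) ^ (-(γ - p)) * sobolevNorm γ v₂) ∧
    |∫ ω, (‖field u t ω‖ ^ 2 - ‖Uκ ω‖ ^ 2) ∂P| ≤ 2 * (c + c * (3 * C / (α - 2))) *
      ((κ : ℝ) ^ (-(α - 2 - 2 * p)) + (κ : ℝ) ^ (-(2 * (β - (p + 1)))) * sobolevNorm β v₁ ^ 2 +
        (κ : ℝ) ^ (-(2 * (γ - p))) * sobolevNorm γ v₂ ^ 2) := by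
  have hκ0 : 0 < κ := by omega
  have hκ' : (0 : ℝ) < κ := by exact_mod_cast hκ0
  have hs₁ := summable_eigen_rpow_mul_power hβ hv₁
  have hs₂ := summable_eigen_rpow_mul_power hγ hv₂
  have hs : Summable fun l =>
      c * (eigen l ^ (p + 1) * power v₁ l + eigen l ^ p * power v₂ l) := (hs₁.add hs₂).mul_left c
  have hds : Summable fun l => ∑ m ∈ orders l, ‖d l m‖ ^ 2 :=
    Summable.of_nonneg_of_le (fun l => Finset.sum_nonneg fun _ _ => by positivity) hd hs
  obtain ⟨hns, hnt⟩ := noise_tail hC hα hp hA hdecay hκ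
  have hqs : Summable fun l : ℕ => (2 * (l : ℝ) + 1) * (c * (A l * eigen l ^ p)) := by
    refine (hns.mul_left c).congr fun l => ?_
    ring
  obtain ⟨c₁, c₂, c₃, c₄, c₅⟩ := field_truncation hu hUκ hw hw0 hwq
    (fun l => mul_nonneg (by linarith)
      (mul_nonneg (hA l) (Real.rpow_nonneg (eigen_pos l).le p))) hds hqs
  set a₁ := (κ : ℝ) ^ (-(β - (p + 1))) * sobolevNorm β v₁ with ha₁
  set a₂ := (κ : ℝ) ^ (-(γ - p)) * sobolevNorm γ v₂ with ha₂
  have h₁ : 0 ≤ a₁ := mul_nonneg (by positivity) (sobolevNorm_nonneg _ _)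
  have h₂ : 0 ≤ a₂ := mul_nonneg (by positivity) (sobolevNorm_nonneg _ _)
  have esq : ∀ x : ℝ, (κ : ℝ) ^ (-(2 * x)) = ((κ : ℝ) ^ (-x)) ^ 2 := by
    intro x
    rw [← Real.rpow_two, ← Real.rpow_mul hκ'.le]
    congr 1
    ring
  have e₁ : (κ : ℝ) ^ (-(2 * (β - (p + 1)))) * sobolevNorm β v₁ ^ 2 = a₁ ^ 2 := by
    rw [esq, ha₁]; ring
  have e₂ : (κ : ℝ) ^ (-(2 * (γ - p))) * sobolevNorm γ v₂ ^ 2 = a₂ ^ 2 := by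
    rw [esq, ha₂]; ring
  have t₁ := tsum_eigen_rpow_mul_power_le hβ hv₁ hκ0
  have t₂ := tsum_eigen_rpow_mul_power_le hγ hv₂ hκ0
  rw [e₁] at t₁
  rw [e₂] at t₂
  have hs₁' : Summable fun l => eigen (l + (κ + 1)) ^ (p + 1) * power v₁ (l + (κ + 1)) :=
    (summable_nat_add_iff (f := fun l => eigen l ^ (p + 1) * power v₁ l) (κ + 1)).2 hs₁
  have hs₂' : Summable fun l => eigen (l + (κ + 1)) ^ p * power v₂ (l + (κ + 1)) :=
    (summable_nat_add_iff (f := fun l => eigen l ^ p * power v₂ l) (κ + 1)).2 hs₂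
  have hds' : Summable fun l => ∑ m ∈ orders (l + (κ + 1)), ‖d (l + (κ + 1)) m‖ ^ 2 :=
    (summable_nat_add_iff (f := fun l => ∑ m ∈ orders l, ‖d l m‖ ^ 2) (κ + 1)).2 hds
  have hδ : ∑' l, ∑ m ∈ orders (l + (κ + 1)), ‖d (l + (κ + 1)) m‖ ^ 2 ≤
      c * (a₁ ^ 2 + a₂ ^ 2) := by
    refine (hds'.tsum_le_tsum (fun l => hd (l + (κ + 1))) ((hs₁'.add hs₂').mul_left c)).trans ?_
    rw [tsum_mul_left, hs₁'.tsum_add hs₂']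
    gcongr
  set θ := 3 * C / (α - 2) with hθ
  have hθ0 : 0 ≤ θ := by
    have : 0 < α - 2 := by linarith
    positivity
  have hς : ∑' l, (2 * ((l + (κ + 1) : ℕ) : ℝ) + 1) *
      (c * (A (l + (κ + 1)) * eigen (l + (κ + 1)) ^ p)) ≤
      c * (θ * (κ : ℝ) ^ (-(α - 2 - 2 * p))) := by
    simp_rw [mul_left_comm _ c, tsum_mul_left]
    gcongr
  have hcθ : 0 ≤ c * θ := by positivity
  refine ⟨c₁, c₂, c₃, c₄.trans ?_, c₅.trans ?_⟩
  · rw [Real.sqrt_le_left (by positivity)]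
    refine hδ.trans ?_
    -- As c ≥ 1, the final constant is at least 2c, so its square exceeds c; the bound under the
    -- square root then needs no constant of its own.
    have hc2 : c ≤ (2 * (c + c * θ)) ^ 2 := by nlinarith
    have h3 : a₁ ^ 2 + a₂ ^ 2 ≤ (a₁ + a₂) ^ 2 := by nlinarith [mul_nonneg h₁ h₂]
    have h4 := mul_le_mul hc2 h3 (by positivity) (by positivity)
    rwa [← mul_pow] at h4
  · rw [e₁, e₂]
    set b := (κ : ℝ) ^ (-(α - 2 - 2 * p)) with hb
    have hb0 : 0 ≤ b := by positivity
    have h4 : 0 ≤ c * b := by positivity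
    have h5 : 0 ≤ c * θ * (a₁ ^ 2 + a₂ ^ 2) := by positivity
    nlinarith

end Truncation

/-! ### Explicit coefficients of the solution and of the scheme -/

section Solution

variable {Ω : Type*} [MeasurableSpace Ω] {P : Measure Ω}

theorem IsWaveSolution.ae_eq {T : ℝ} {v₁ v₂ : L2} {a u₁ u₂ : ℕ → ℤ → ℝ → Ω → ℂ}
    (h : IsWaveSolution P T v₁ v₂ a u₁ u₂) {B : ℕ → ℝ}
    (ha : ∀ l, ∀ m ∈ orders l, IsCentredNoise (a l m) (B l) P) {t : ℝ} (ht : t ∈ Set.Icc 0 T)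
    {n : ℕ} {τ : ℕ → ℝ} (hτ0 : τ 0 = 0) (hτ : ∀ j < n, τ j < τ (j + 1)) (hτn : τ n = t) :
    ∀ᵐ ω ∂P, ∀ l, ∀ m ∈ orders l,
      u₁ l m t ω = ((R2 l t : ℂ) * coeff v₁ l m + (R1 l t : ℂ) * coeff v₂ l m) +
        wienerIntegral (fun s => R1 l (t - s)) (fun s => a l m s ω) 0 t ∧
      u₂ l m t ω = (-((l : ℂ) * (l + 1)) * (R1 l t : ℂ) * coeff v₁ l m +
        (R2 l t : ℂ) * coeff v₂ l m) +
        wienerIntegral (fun s => R2 l (t - s)) (fun s => a l m s ω) 0 t ∧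
      recursion l (coeff v₁ l m) (coeff v₂ l m) (fun s => a l m s ω) τ n =
        (u₁ l m t ω, u₂ l m t ω) := by
  -- There are countably many pairs (ℓ, m), so one null set serves all coefficients.
  refine ae_all_iff.2 fun l => ae_all_iff.2 fun m => Filter.eventually_imp_distrib_left.2 fun hm => ?_
  filter_upwards [h.continuous₁ l m hm, h.continuous₂ l m hm, h.position l m hm,
    h.velocity l m hm, (ha l m hm).continuous, (ha l m hm).zero] with ω h1 h2 hp hv hc h0
  have hz : (0 : ℝ) ∈ Set.Icc 0 T := ⟨le_rfl, ht.1.trans ht.2⟩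
  obtain ⟨k₁, k₂⟩ := variation_of_constants h1 h2 hc hp hv le_rfl ht.1 ht.2
  have i₁ : u₁ l m 0 ω = coeff v₁ l m := by rw [hp 0 hz]; simp
  have i₂ : u₂ l m 0 ω = coeff v₂ l m := by rw [hv 0 hz]; simp [h0]
  simp only [sub_zero, i₁, i₂] at k₁ k₂
  refine ⟨k₁, k₂, ?_⟩
  have := recursion_eq_solution h1 h2 hc h0 hp hv hτ0 hτ (hτn.le.trans ht.2)
  rwa [hτn] at this

end Solution

/-- Halving `c` in the hypotheses leaves room for the factor 2 of ‖x + y‖² ≤ 2‖x‖² + 2‖y‖². -/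
theorem sum_norm_sq_le {x y e f c : ℝ} (hx : x ^ 2 ≤ c / 2 * e) (hy : y ^ 2 ≤ c / 2 * f)
    (v₁ v₂ : L2) (l : ℕ) :
    ∑ m ∈ orders l, ‖(x : ℂ) * coeff v₁ l m + (y : ℂ) * coeff v₂ l m‖ ^ 2 ≤
      c * (e * power v₁ l + f * power v₂ l) := by
  rw [power, power, Finset.mul_sum, Finset.mul_sum, ← Finset.sum_add_distrib, Finset.mul_sum]
  refine Finset.sum_le_sum fun m _ => ?_
  have h := norm_add_le ((x : ℂ) * coeff v₁ l m) ((y : ℂ) * coeff v₂ l m)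
  rw [norm_mul, norm_mul, Complex.norm_real, Complex.norm_real] at h
  set a := ‖coeff v₁ l m‖
  set b := ‖coeff v₂ l m‖
  have h2 := pow_le_pow_left₀ (norm_nonneg _) h 2
  have h3 : (‖x‖ * a + ‖y‖ * b) ^ 2 ≤ 2 * (x ^ 2 * a ^ 2) + 2 * (y ^ 2 * b ^ 2) := by
    have ex : ‖x‖ ^ 2 = x ^ 2 := by rw [Real.norm_eq_abs, sq_abs]
    have ey : ‖y‖ ^ 2 = y ^ 2 := by rw [Real.norm_eq_abs, sq_abs]
    rw [← ex, ← ey]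
    nlinarith [sq_nonneg (‖x‖ * a - ‖y‖ * b)]
  have h4 := mul_le_mul_of_nonneg_right hx (sq_nonneg a)
  have h5 := mul_le_mul_of_nonneg_right hy (sq_nonneg b)
  linarith

end SphereWave

/-! ### The weak error estimates for position and velocity -/

theorem proposition4p3 (T C α : ℝ) (hT : 0 < T) (hC : 0 < C) (hα : 2 < α) :
    ∃ K : ℝ, 0 < K ∧
      ∀ (Ω : Type*) [MeasurableSpace Ω] (P : Measure Ω) [IsProbabilityMeasure P]
        -- the driving noise
        (A : ℕ → ℝ) (l₀ : ℕ) (_ : ∀ l, 0 ≤ A l) (_ : ∀ l > l₀, A l ≤ C * (l : ℝ) ^ (-α))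
        (b : Fin 2 → ℕ → ℕ → ℝ≥0 → Ω → ℝ) (_ : SphereWave.IsBrownianFamily b P)
        -- the initial values
        (v₁ v₂ : SphereWave.L2) (β γ : ℝ)
        (_ : SphereWave.MemSobolev β v₁) (_ : SphereWave.MemSobolev γ v₂)
        -- the solution
        (u₁ u₂ : ℕ → ℤ → ℝ → Ω → ℂ)
        (_ : SphereWave.IsWaveSolution P T v₁ v₂ (SphereWave.noiseCoeff A b) u₁ u₂)
        -- the time grid and the truncation index
        (t : ℝ) (_ : t ∈ Set.Icc 0 T) (n : ℕ) (τ : ℕ → ℝ)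
        (_ : τ 0 = 0) (_ : ∀ j < n, τ j < τ (j + 1)) (_ : τ n = t)
        (κ : ℕ) (_ : l₀ < κ),
        -- the position
        (0 ≤ β → -1 ≤ γ →
          let U := SphereWave.field u₁ t
          let Uκ := SphereWave.approxPosition κ v₁ v₂ (SphereWave.noiseCoeff A b) τ n
          SphereWave.FieldConverges P u₁ t ∧ MemLp U 2 P ∧ MemLp Uκ 2 P ∧
          ‖∫ ω, (U ω - Uκ ω) ∂P‖ ≤
            K * ((κ : ℝ) ^ (-β) * SphereWave.sobolevNorm β v₁
              + (κ : ℝ) ^ (-(γ + 1)) * SphereWave.sobolevNorm γ v₂) ∧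
          |∫ ω, (‖U ω‖ ^ 2 - ‖Uκ ω‖ ^ 2) ∂P| ≤
            K * ((κ : ℝ) ^ (-α) + (κ : ℝ) ^ (-(2 * β)) * SphereWave.sobolevNorm β v₁ ^ 2
              + (κ : ℝ) ^ (-(2 * (γ + 1))) * SphereWave.sobolevNorm γ v₂ ^ 2)) ∧
        -- the velocity
        (1 ≤ β → 0 ≤ γ →
          let U := SphereWave.field u₂ t
          let Uκ := SphereWave.approxVelocity κ v₁ v₂ (SphereWave.noiseCoeff A b) τ n
          SphereWave.FieldConverges P u₂ t ∧ MemLp U 2 P ∧ MemLp Uκ 2 P ∧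
          ‖∫ ω, (U ω - Uκ ω) ∂P‖ ≤
            K * ((κ : ℝ) ^ (-(β - 1)) * SphereWave.sobolevNorm β v₁
              + (κ : ℝ) ^ (-γ) * SphereWave.sobolevNorm γ v₂) ∧
          |∫ ω, (‖U ω‖ ^ 2 - ‖Uκ ω‖ ^ 2) ∂P| ≤
            K * ((κ : ℝ) ^ (-(α - 2)) + (κ : ℝ) ^ (-(2 * (β - 1))) * SphereWave.sobolevNorm β v₁ ^ 2
              + (κ : ℝ) ^ (-(2 * γ)) * SphereWave.sobolevNorm γ v₂ ^ 2)) := by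
  -- Large enough for both kinds of terms: noise needs 2T(2 + T²), from variance 2A_ℓ, propagator
  -- bound 2 + T² and a time interval of length at most T; initial data need 2(2 + T²).
  set c : ℝ := 2 * (1 + T) * (2 + T ^ 2) with hc
  have hc1 : 1 ≤ c := by rw [hc]; nlinarith [sq_nonneg T, mul_pos hT (pow_pos hT 2)]
  have hc0 : 0 ≤ c := zero_le_one.trans hc1
  have hα' : 0 < α - 2 := by linarith
  have hcT : 2 * T * (2 + T ^ 2) ≤ c := by rw [hc]; nlinarith [sq_nonneg T]
  have hc2 : 2 + T ^ 2 ≤ c / 2 := by rw [hc]; nlinarith [sq_nonneg T, mul_pos hT (pow_pos hT 2)]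
  refine ⟨2 * (c + c * (3 * C / (α - 2))), by positivity, ?_⟩
  intro Ω _ P _ A l₀ hA hdecay b hb v₁ v₂ β γ hv₁ hv₂ u₁ u₂ hsol t ht n τ hτ0 hτ hτn κ hκ
  have hX : ∀ l, ∀ m ∈ SphereWave.orders l,
      SphereWave.IsCentredNoise (SphereWave.noiseCoeff A b l m) (2 * A l) P :=
    fun l m hm => SphereWave.isCentredNoise_noiseCoeff hA hb hm
  have hA2 : ∀ l, 0 ≤ 2 * A l := fun l => by linarith [hA l]
  have hae := hsol.ae_eq hX ht hτ0 hτ hτn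
  have hR1 : ∀ l, ContDiff ℝ 1 fun s => SphereWave.R1 l (t - s) := fun l =>
    (SphereWave.contDiff_R1 l).comp (contDiff_const.sub contDiff_id)
  have hR2 : ∀ l, ContDiff ℝ 1 fun s => SphereWave.R2 l (t - s) := fun l =>
    (SphereWave.contDiff_R2 l).comp (contDiff_const.sub contDiff_id)
  have htT : t - 0 ≤ T := by linarith [ht.2]
  have hone : ∀ l, SphereWave.eigen l ^ (0 : ℝ) = 1 := fun l => Real.rpow_zero _
  constructor
  · intro hβ hγ
    -- For the position R₂ acts on v₁ with weight 1, while R₁ acts on v₂ and on the noise with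
    -- squared size of order λ^(-1); hence p = -1.
    have key := SphereWave.truncation_bounds (P := P) (u := u₁) (t := t) (p := -1) (κ := κ)
      (d := fun l m => (SphereWave.R2 l t : ℂ) * SphereWave.coeff v₁ l m +
        (SphereWave.R1 l t : ℂ) * SphereWave.coeff v₂ l m)
      (w := fun l m ω => SphereWave.wienerIntegral (fun s => SphereWave.R1 l (t - s))
        (fun s => SphereWave.noiseCoeff A b l m s ω) 0 t)
      (Uκ := SphereWave.approxPosition κ v₁ v₂ (SphereWave.noiseCoeff A b) τ n)
      hC hα hc1 (by norm_num) hA hdecay hκ hv₁ hv₂ (by linarith) hγ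
      (by filter_upwards [hae] with ω hω l m hm using (hω l m hm).1)
      (by
        filter_upwards [hae] with ω hω
        refine Finset.sum_congr rfl fun l _ => Finset.sum_congr rfl fun m hm => ?_
        rw [(hω l m hm).2.2])
      (fun l m hm => (hX l m hm).aestronglyMeasurable_wienerIntegral (hR1 l) ht.1)
      (fun l m hm => (hX l m hm).integral_wienerIntegral (hA2 l) (hR1 l) le_rfl ht.1)
      (by
        intro l m hm
        have he : 0 ≤ SphereWave.eigen l ^ (-1 : ℝ) :=
          Real.rpow_nonneg (SphereWave.eigen_pos l).le _
        refine ((hX l m hm).lintegral_wienerIntegral_le (hA2 l) (hR1 l) le_rfl ht.1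
          (M := Real.sqrt ((2 + T ^ 2) * SphereWave.eigen l ^ (-1 : ℝ))) fun s hs =>
          Real.abs_le_sqrt (SphereWave.R1_sq_le
            ⟨by linarith [hs.2], by linarith [hs.1, ht.2]⟩)).trans ?_
        refine ENNReal.ofReal_le_ofReal ?_
        rw [Real.sq_sqrt (by positivity)]
        calc 2 * A l * ((2 + T ^ 2) * SphereWave.eigen l ^ (-1 : ℝ) * (t - 0))
            ≤ 2 * A l * ((2 + T ^ 2) * SphereWave.eigen l ^ (-1 : ℝ) * T) := by
              have := hA2 l
              gcongr
          _ = 2 * T * (2 + T ^ 2) * (A l * SphereWave.eigen l ^ (-1 : ℝ)) := by ring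
          _ ≤ c * (A l * SphereWave.eigen l ^ (-1 : ℝ)) :=
              mul_le_mul_of_nonneg_right hcT (mul_nonneg (hA l) he))
      (by
        intro l
        have he : 0 ≤ SphereWave.eigen l ^ (-1 : ℝ) :=
          Real.rpow_nonneg (SphereWave.eigen_pos l).le _
        refine SphereWave.sum_norm_sq_le ?_ ?_ v₁ v₂ l
        · rw [neg_add_cancel, hone]
          nlinarith [SphereWave.R2_sq_le l t, sq_nonneg T]
        · exact (SphereWave.R1_sq_le ht).trans (mul_le_mul_of_nonneg_right hc2 he))
    rw [show β - (-1 + 1) = β by ring, show γ - -1 = γ + 1 by ring,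
      show α - 2 - 2 * -1 = α by ring] at key
    exact key
  · intro hβ hγ
    -- One derivative is lost in every term: ℓ(ℓ+1) R₁ acts on v₁ with squared size at most λ, and
    -- R₂ acts on v₂ and on the noise with weight 1; hence p = 0.
    have key := SphereWave.truncation_bounds (P := P) (u := u₂) (t := t) (p := 0) (κ := κ)
      (d := fun l m => -((l : ℂ) * (l + 1)) * (SphereWave.R1 l t : ℂ) * SphereWave.coeff v₁ l m +
        (SphereWave.R2 l t : ℂ) * SphereWave.coeff v₂ l m)
      (w := fun l m ω => SphereWave.wienerIntegral (fun s => SphereWave.R2 l (t - s))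
        (fun s => SphereWave.noiseCoeff A b l m s ω) 0 t)
      (Uκ := SphereWave.approxVelocity κ v₁ v₂ (SphereWave.noiseCoeff A b) τ n)
      hC hα hc1 le_rfl hA hdecay hκ hv₁ hv₂ (by linarith) hγ
      (by filter_upwards [hae] with ω hω l m hm using (hω l m hm).2.1)
      (by
        filter_upwards [hae] with ω hω
        refine Finset.sum_congr rfl fun l _ => Finset.sum_congr rfl fun m hm => ?_
        rw [(hω l m hm).2.2])
      (fun l m hm => (hX l m hm).aestronglyMeasurable_wienerIntegral (hR2 l) ht.1)
      (fun l m hm => (hX l m hm).integral_wienerIntegral (hA2 l) (hR2 l) le_rfl ht.1)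
      (by
        intro l m hm
        refine ((hX l m hm).lintegral_wienerIntegral_le (hA2 l) (hR2 l) le_rfl ht.1
          (M := 1) fun s _ => Real.abs_cos_le_one _).trans ?_
        refine ENNReal.ofReal_le_ofReal ?_
        rw [hone]
        have h1 : 2 * A l * (1 ^ 2 * (t - 0)) ≤ 2 * A l * T := by
          have := hA2 l
          rw [one_pow, one_mul]
          gcongr
        have h2 : 2 * T ≤ c := by nlinarith [sq_nonneg T, mul_pos hT (pow_pos hT 2)]
        nlinarith [mul_le_mul_of_nonneg_right h2 (hA l)])
      (by
        intro l
        have he : 0 ≤ SphereWave.eigen l ^ (1 : ℝ) :=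
          Real.rpow_nonneg (SphereWave.eigen_pos l).le _
        have hc3 : 1 ≤ c / 2 := by nlinarith [sq_nonneg T]
        have h := SphereWave.sum_norm_sq_le (x := -((l : ℝ) * (l + 1) * SphereWave.R1 l t))
          (y := SphereWave.R2 l t) (e := SphereWave.eigen l ^ (0 + 1 : ℝ))
          (f := SphereWave.eigen l ^ (0 : ℝ)) (c := c)
          (by
            rw [neg_sq, zero_add]
            exact (SphereWave.eigenvalue_mul_R1_sq_le l t).trans
              (le_mul_of_one_le_left he hc3))
          (by
            rw [hone]
            linarith [SphereWave.R2_sq_le l t]) v₁ v₂ l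
        refine le_of_eq_of_le (Finset.sum_congr rfl fun m _ => ?_) h
        push_cast
        ring_nf)
    rw [show β - (0 + 1) = β - 1 by ring, sub_zero, mul_zero, sub_zero] at key
    exact key
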